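/- Let $V$ be a finite set of Boolean variables. A pure Horn function on $V$ is a Boolean function $h:\{0,1\}^V\to\{0,1\}$ that is represented by a (possibly empty) conjunction of clauses $A\to v=v\vee\bigvee_{a\in A}\bar a$ with $A\subseteq V$ and $v\in V$. A clause $A\to v$ is an implicate of $h$ if it is satisfied by every $x$ with $h(x)=1$. A set $K\subseteq V$ is a key of $h$ if $K\to v$ is an implicate of $h$ for all $v\in V\setminus K$. A graph $G=(V,E)$ is called a unique key graph if there is exactly one pure Horn function $h$ on $V$ whose set of inclusionwise minimal keys is $E$ (edges being viewed as two-element subsets of $V$). An induced matching of $G$ is a matching $M\subseteq E$ such that every edge of $G$ joining two vertices covered by $M$ belongs to $M$; its size is the number of its edges. **Theorem.** For every constant $p\in\mathbb{N}$ there is a polynomial-time algorithm (a deterministic Turing machine running in time polynomial in the size of the input graph, given by its adjacency matrix, where the polynomial may depend on $p$) that, for every finite simple graph $G$ all of whose induced matchings have size at most $p$, decides whether $G$ is a unique key graph. -/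

import Mathlib

/-- The pure Horn clause `A → v`, that is `v ∨ ⋁_{a ∈ A} ¬a`, holds at the Boolean vector `x`. -/
def ClauseHolds {V : Type*} (A : Finset V) (v : V) (x : V → Bool) : Prop :=
  (∀ a ∈ A, x a = true) → x v = true

/-- A Boolean function is pure Horn if it is represented by a pure Horn CNF: a finite (possibly
empty) conjunction of clauses `A → v`, here given as pairs `(A, v)`. -/
def IsPureHorn {V : Type*} (h : (V → Bool) → Bool) : Prop :=
  ∃ Φ : Finset (Finset V × V), ∀ x, h x = true ↔ ∀ c ∈ Φ, ClauseHolds c.1 c.2 x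

/-- `A → v` is an implicate of `h`: it holds at every true vector of `h`. -/
def IsImplicate {V : Type*} (h : (V → Bool) → Bool) (A : Finset V) (v : V) : Prop :=
  ∀ x, h x = true → ClauseHolds A v x

/-- `K` is a key of `h`. -/
def IsKey {V : Type*} (h : (V → Bool) → Bool) (K : Finset V) : Prop :=
  ∀ v, v ∉ K → IsImplicate h K v

/-- The set of (inclusionwise) minimal keys of `h`. -/
def minimalKeys {V : Type*} (h : (V → Bool) → Bool) : Set (Finset V) :=
  {K | Minimal (IsKey h) K}

/-- A unique key hypergraph: a Sperner hypergraph that is the set of minimal keys of exactly one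
pure Horn function. -/
def IsUniqueKeyHypergraph {V : Type*} (B : Set (Finset V)) : Prop :=
  IsAntichain (· ⊆ ·) B ∧ ∃! h : (V → Bool) → Bool, IsPureHorn h ∧ minimalKeys h = B

/-- A unique key graph: its edges, as two-element vertex sets, form a unique key hypergraph. -/
def IsUniqueKeyGraph {V : Type*} [DecidableEq V] (G : SimpleGraph V) : Prop :=
  IsUniqueKeyHypergraph {B : Finset V | ∃ u v, G.Adj u v ∧ B = {u, v}}

/-- Every induced matching of `G` has at most `p` edges. An induced matching is a matching that
contains every edge of `G` joining two of its vertices. -/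
def InducedMatchingsAtMost {V : Type*} (G : SimpleGraph V) (p : ℕ) : Prop :=
  ∀ M : G.Subgraph, M.IsMatching → M.IsInduced → M.edgeSet.ncard ≤ p

/-- Finite graphs as inputs of algorithms: the vertices are numbered `0, …, n - 1`. -/
abbrev FiniteGraph : Type := Σ n : ℕ, SimpleGraph (Fin n)

open Classical in
/-- The encoding of a graph as a bit string: the number `n` of vertices in unary, as `1ⁿ0`,
followed by the `n` rows of the adjacency matrix. -/
noncomputable def encodeGraph (G : FiniteGraph) : List Bool :=
  List.replicate G.1 true ++ false ::
    (List.finRange G.1).flatMap fun i => (List.finRange G.1).map fun j => decide (G.2.Adj i j)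

open Classical in
/-- On the inputs that satisfy the promise `S`, the property `P` is decided in polynomial time in
the length of the encoded input, by a (multi-stack) Turing machine that outputs one bit. Nothing is
asked of the machine on inputs outside `S`. -/
def DecidableInPolyTimeOn {α : Type} (enc : α → List Bool) (S P : α → Prop) : Prop :=
  Nonempty (Turing.TM2ComputableInPolyTime (fun a : {a : α // S a} => enc a.1)
    Computability.encodeBool (fun a : {a : α // S a} => decide (P a.1)))

/-! Let `h₀` be the function given by all clauses `{u, v} → z` with `uv` an edge. If `G` has an
edge, the minimal keys of `h₀` are the edges. Another function with these minimal keys exists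
exactly when some independent set `S` misses the closed neighbourhood of some vertex `v` and
dominates the neighbours of `v` (`Shields`): then `S → v` can be added to `h₀` without creating an
independent key. So `G` is a unique key graph iff it has a vertex and no such pair `S`, `v`
(`isUniqueKeyGraph_iff`).

For fixed `v` only maximal independent sets `S` of `X = V \ N[v]` matter. Order the vertices.
Choosing them greedily need not give `S`: a vertex outside `S` may have its first neighbour in `S`
only later. A sequence of pairs `(s, u)`, with `s` in `S` and `u` such a vertex, corrects all these
errors, and the pairs can be taken to form an induced matching
(`exists_inducedMatching_of_maximal`). Hence at most `p` pairs determine `S`, and it suffices to try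
all `n ^ (2 * p + 1)` choices of `v` and `p` pairs, rebuilding one candidate set for each
(`exists_shields_iff`).

To obtain a Turing machine, the search is written in a small language of stack programs, which
compiles step by step to a multi-stack machine (`Exec.steps`). The predicate `Comp` records
evaluation in polynomial time; it is closed under Boolean operations, bounded quantification
(`Comp.ex`) and greedy construction of a set (`Comp.iterate`). -/

section UniqueKey

/-! ### Unique key graphs and shielding sets. -/

variable {V : Type*}

open Classical in
/-- The pure Horn function represented by a set of clauses. -/
noncomputable def hornFunction (Φ : Finset (Finset V × V)) (x : V → Bool) : Bool :=
  decide (∀ c ∈ Φ, ClauseHolds c.1 c.2 x)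

theorem hornFunction_eq_true {Φ : Finset (Finset V × V)} {x : V → Bool} :
    hornFunction Φ x = true ↔ ∀ c ∈ Φ, ClauseHolds c.1 c.2 x := by
  simp [hornFunction]

theorem isPureHorn_hornFunction (Φ : Finset (Finset V × V)) : IsPureHorn (hornFunction Φ) :=
  ⟨Φ, fun _ => hornFunction_eq_true⟩

theorem IsKey.eq_true {h : (V → Bool) → Bool} {K : Finset V} (hK : IsKey h K) {x : V → Bool}
    (hx : h x = true) (hKx : ∀ a ∈ K, x a = true) (v : V) : x v = true := by
  by_cases hv : v ∈ K
  · exact hKx v hv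
  · exact hK v hv x hx hKx

/-- The independent set `S` avoids the closed neighbourhood of `v` and dominates the neighbours
of `v`. -/
structure SimpleGraph.Shields (G : SimpleGraph V) (S : Set V) (v : V) : Prop where
  indep : ∀ a ∈ S, ∀ b ∈ S, ¬G.Adj a b
  notMem : v ∉ S
  not_adj : ∀ s ∈ S, ¬G.Adj s v
  dominates : ∀ u, G.Adj v u → ∃ s ∈ S, G.Adj s u

variable [DecidableEq V] {G : SimpleGraph V}

theorem minimalKeys_eq_edges {h : (V → Bool) → Bool}
    (he : ∀ u v, G.Adj u v → IsKey h {u, v})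
    (hi : ∀ K : Finset V, (∀ a ∈ K, ∀ b ∈ K, ¬G.Adj a b) → ¬IsKey h K) :
    minimalKeys h = {B : Finset V | ∃ u v, G.Adj u v ∧ B = {u, v}} := by
  have hedge : ∀ K, IsKey h K → ∃ u ∈ K, ∃ v ∈ K, G.Adj u v := by
    intro K hK
    by_contra! hc
    exact hi K hc hK
  ext K
  constructor
  · intro hK
    obtain ⟨u, hu, v, hv, huv⟩ := hedge K hK.1
    refine ⟨u, v, huv, le_antisymm (hK.2 (he u v huv) ?_) ?_⟩ <;>
      simp [Finset.insert_subset_iff, hu, hv]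
  · rintro ⟨u, v, huv, rfl⟩
    refine ⟨he u v huv, fun K hK hle => ?_⟩
    obtain ⟨a, ha, b, hb, hab⟩ := hedge K hK
    have h1 := hle ha
    have h2 := hle hb
    simp only [Finset.mem_insert, Finset.mem_singleton] at h1 h2
    have := hab.ne
    rcases h1 with rfl | rfl <;> rcases h2 with rfl | rfl <;>
      simp_all [Finset.insert_subset_iff]

theorem not_isKey_of_indep {Φ : Finset (Finset V × V)} {K K' : Finset V} {u v : V}
    (huv : G.Adj u v) (hKK' : K ⊆ K') (hK' : ∀ a ∈ K', ∀ b ∈ K', ¬G.Adj a b)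
    (h : ∀ c ∈ Φ, ClauseHolds c.1 c.2 fun a => decide (a ∈ K')) : ¬IsKey (hornFunction Φ) K := by
  intro hK
  have := hK.eq_true (hornFunction_eq_true.2 h) (fun a ha => by simpa using hKK' ha)
  exact hK' u (by simpa using this u) v (by simpa using this v) huv

variable [Fintype V]

open Classical in
/-- The clauses that make every edge of a graph a key. -/
noncomputable def edgeClauses (G : SimpleGraph V) : Finset (Finset V × V) :=
  Finset.univ.filter fun c => ∃ u v, G.Adj u v ∧ c.1 = {u, v}

theorem isKey_edge {Φ : Finset (Finset V × V)} (hΦ : edgeClauses G ⊆ Φ) {u v : V}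
    (huv : G.Adj u v) : IsKey (hornFunction Φ) {u, v} := by
  intro z _ x hx
  exact hornFunction_eq_true.1 hx ({u, v}, z) (hΦ (by simpa [edgeClauses] using ⟨u, v, huv, rfl⟩))

/-- The indicator function of an independent set satisfies the edge clauses. -/
theorem clauseHolds_of_mem_edgeClauses {K : Finset V} (hK : ∀ a ∈ K, ∀ b ∈ K, ¬G.Adj a b)
    {c : Finset V × V} (hc : c ∈ edgeClauses G) : ClauseHolds c.1 c.2 fun a => decide (a ∈ K) := by
  obtain ⟨u, v, huv, hc⟩ : ∃ u v, G.Adj u v ∧ c.1 = {u, v} := by simpa [edgeClauses] using hc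
  intro h
  rw [hc] at h
  simp only [Finset.mem_insert, Finset.mem_singleton, forall_eq_or_imp, forall_eq,
    decide_eq_true_iff] at h
  exact absurd huv (hK u h.1 v h.2)

theorem exists_adj_of_minimalKeys {h : (V → Bool) → Bool}
    (hh : minimalKeys h = {B : Finset V | ∃ u v, G.Adj u v ∧ B = {u, v}}) : ∃ u v, G.Adj u v := by
  obtain ⟨K, -, hK⟩ := Set.Finite.exists_le_minimal (s := {K | IsKey h K}) (Set.toFinite _)
    (show IsKey h Finset.univ from fun v hv => absurd (Finset.mem_univ v) hv)
  have : K ∈ minimalKeys h := hK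
  rw [hh] at this
  obtain ⟨u, v, huv, -⟩ := this
  exact ⟨u, v, huv⟩

theorem minimalKeys_hornFunction_edgeClauses {u v : V} (huv : G.Adj u v) :
    minimalKeys (hornFunction (edgeClauses G)) =
      {B : Finset V | ∃ u v, G.Adj u v ∧ B = {u, v}} :=
  minimalKeys_eq_edges (fun _ _ h => isKey_edge subset_rfl h) fun _ hK =>
    not_isKey_of_indep huv subset_rfl hK fun _ => clauseHolds_of_mem_edgeClauses hK

/-- An independent `K` containing `S` has no neighbour of `w`, because `S` dominates those; so `K ∪
{w}` is independent and its indicator is a true vector. If `K` does not contain `S`, the new clause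
is vacuous at the indicator of `K`. -/
theorem minimalKeys_hornFunction_insert {u v w : V} {S : Finset V} (huv : G.Adj u v)
    (hS : G.Shields (S : Set V) w) : minimalKeys (hornFunction (insert (S, w) (edgeClauses G))) =
      {B : Finset V | ∃ u v, G.Adj u v ∧ B = {u, v}} := by
  refine minimalKeys_eq_edges (fun _ _ h => isKey_edge (Finset.subset_insert _ _) h) fun K hK => ?_
  by_cases hSK : S ⊆ K
  · have hw : ∀ a ∈ K, ¬G.Adj w a := by
      intro a ha hwa
      obtain ⟨s, hs, hsa⟩ := hS.dominates a hwa
      exact hK s (hSK hs) a ha hsa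
    have hK' : ∀ a ∈ insert w K, ∀ b ∈ insert w K, ¬G.Adj a b := by
      simp only [Finset.mem_insert]
      rintro a (rfl | ha) b (rfl | hb)
      · exact G.loopless.irrefl _
      · exact hw b hb
      · exact fun h => hw a ha h.symm
      · exact hK a ha b hb
    refine not_isKey_of_indep huv (Finset.subset_insert w K) hK' fun c hc => ?_
    rcases Finset.mem_insert.1 hc with rfl | hc
    · intro _
      simp
    · exact clauseHolds_of_mem_edgeClauses hK' hc
  · refine not_isKey_of_indep huv subset_rfl hK fun c hc => ?_
    rcases Finset.mem_insert.1 hc with rfl | hc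
    · intro h
      exact absurd (fun a ha => by simpa using h a ha) hSK
    · exact clauseHolds_of_mem_edgeClauses hK hc

/-- Only the true vectors `x` of the edge function with independent support need work. If `x`
violates a clause `A → v` of `h`, then `A` lies in an independent set `T` containing a neighbour `u`
of `v`. Every true vector of `h` above `T` is then true at `v` and `u`, hence everywhere, which
makes `T` a key without an edge. -/
theorem eq_hornFunction_of_minimalKeys {h : (V → Bool) → Bool} (hh : IsPureHorn h)
    (hmin : minimalKeys h = {B : Finset V | ∃ u v, G.Adj u v ∧ B = {u, v}})
    (hG : ∀ S v, ¬G.Shields S v) : h = hornFunction (edgeClauses G) := by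
  obtain ⟨Φ, hΦ⟩ := hh
  funext x
  rw [Bool.eq_iff_iff, hornFunction_eq_true]
  constructor
  · intro hx c hc
    obtain ⟨u, v, huv, hc⟩ : ∃ u v, G.Adj u v ∧ c.1 = {u, v} := by simpa [edgeClauses] using hc
    have hm : c.1 ∈ minimalKeys h := by
      rw [hmin]
      exact ⟨u, v, huv, hc⟩
    exact fun h => hm.1.eq_true hx h c.2
  · intro hx
    by_cases hall : ∀ a, x a = true
    · exact (hΦ x).2 fun c _ _ => hall c.2
    have hind : ∀ a, x a = true → ∀ b, x b = true → ¬G.Adj a b := by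
      intro a ha b hb hab
      refine hall fun z => hx ({a, b}, z) (by simpa [edgeClauses] using ⟨a, b, hab, rfl⟩) ?_
      simp [ha, hb]
    rw [hΦ]
    rintro ⟨A, v⟩ hc hA
    by_contra hv
    -- Either the support of `x` already meets the neighbourhood of `v`, or, as it does not shield
    -- `v`, it leaves some neighbour `u` undominated, which can be added.
    obtain ⟨T, hTx, hT, u, huT, hvu⟩ : ∃ T : Finset V, (∀ a, x a = true → a ∈ T) ∧
        (∀ a ∈ T, ∀ b ∈ T, ¬G.Adj a b) ∧ ∃ u ∈ T, G.Adj v u := by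
      by_cases hu : ∃ u, x u = true ∧ G.Adj v u
      · obtain ⟨u, hu, hvu⟩ := hu
        refine ⟨Finset.univ.filter fun a => x a = true, by simp, ?_, u, by simp [hu], hvu⟩
        simpa using hind
      · by_contra hT
        refine hG {a | x a = true} v ⟨hind, hv, fun s hs hsv => hu ⟨s, hs, hsv.symm⟩, ?_⟩
        intro u hvu
        by_contra! hsu
        refine hT ⟨insert u (Finset.univ.filter fun a => x a = true), by simp +contextual, ?_,
          u, by simp, hvu⟩
        simp only [Finset.mem_insert, Finset.mem_filter, Finset.mem_univ, true_and]
        rintro a (rfl | ha) b (rfl | hb)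
        · exact G.loopless.irrefl _
        · exact fun h => hsu b hb h.symm
        · exact hsu a ha
        · exact hind a ha b hb
    have hTkey : ¬IsKey h T := by
      intro hkey
      obtain ⟨K, hKT, hK⟩ := Set.Finite.exists_le_minimal (s := {K | IsKey h K}) (Set.toFinite _)
        hkey
      have : K ∈ minimalKeys h := hK
      rw [hmin] at this
      obtain ⟨a, b, hab, rfl⟩ := this
      exact hT a (hKT (by simp)) b (hKT (by simp)) hab
    simp only [IsKey, IsImplicate, ClauseHolds] at hTkey
    push Not at hTkey
    obtain ⟨w, hwT, y, hy, hTy, hyw⟩ := hTkey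
    have hyv : y v = true := (hΦ y).1 hy (A, v) hc fun a ha => hTy a (hTx a (hA a ha))
    have hm : ({v, u} : Finset V) ∈ minimalKeys h := by
      rw [hmin]
      exact ⟨v, u, hvu, rfl⟩
    exact hyw (hm.1.eq_true hy (by simp [hyv, hTy u huT]) w)

theorem isUniqueKeyGraph_iff :
    IsUniqueKeyGraph G ↔ Nonempty V ∧ ∀ S v, ¬G.Shields S v := by
  constructor
  · rintro ⟨-, h, ⟨hh, hmin⟩, huniq⟩
    obtain ⟨u, v, huv⟩ := exists_adj_of_minimalKeys hmin
    refine ⟨⟨u⟩, fun S w hS => ?_⟩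
    obtain ⟨S, rfl⟩ : ∃ S' : Finset V, S = S' := ⟨(Set.toFinite S).toFinset, by simp⟩
    have h1 := huniq _ ⟨isPureHorn_hornFunction _, minimalKeys_hornFunction_edgeClauses huv⟩
    have h2 := huniq _ ⟨isPureHorn_hornFunction _, minimalKeys_hornFunction_insert huv hS⟩
    -- The indicator of `S` separates the two functions: it satisfies the edge clauses but violates
    -- `S → w`.
    have h3 : hornFunction (insert (S, w) (edgeClauses G)) (fun a => decide (a ∈ S)) = true := by
      rw [h2, ← h1]
      exact hornFunction_eq_true.2 fun c => clauseHolds_of_mem_edgeClauses hS.indep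
    have h4 := hornFunction_eq_true.1 h3 (S, w) (by simp) (by simp)
    exact hS.notMem (by simpa using h4)
  · rintro ⟨⟨v⟩, hG⟩
    -- An isolated vertex would be shielded by the empty set.
    obtain ⟨u, huv⟩ : ∃ u, G.Adj v u := by
      by_contra! h
      exact hG ∅ v ⟨by simp, by simp, by simp, fun u hu => absurd hu (h u)⟩
    refine ⟨?_, hornFunction (edgeClauses G),
      ⟨isPureHorn_hornFunction _, minimalKeys_hornFunction_edgeClauses huv⟩,
      fun h ⟨hh, hmin⟩ => eq_hornFunction_of_minimalKeys hh hmin hG⟩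
    rintro _ ⟨a, b, hab, rfl⟩ _ ⟨c, d, hcd, rfl⟩ hne hle
    refine hne (Finset.eq_of_subset_of_card_le hle ?_)
    rw [Finset.card_pair hab.ne, Finset.card_pair hcd.ne]

end UniqueKey

/-! ### Encoding maximal independent sets by induced matchings. -/

section Greedy

variable {V : Type*} {G : SimpleGraph V}

/-- There are no edges between the two pairs of vertices. -/
def SimpleGraph.Separated (G : SimpleGraph V) (q r : V × V) : Prop :=
  ¬G.Adj q.1 r.1 ∧ ¬G.Adj q.1 r.2 ∧ ¬G.Adj q.2 r.1 ∧ ¬G.Adj q.2 r.2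

theorem SimpleGraph.Separated.symm {q r : V × V} (h : G.Separated q r) : G.Separated r q :=
  ⟨fun h' => h.1 h'.symm, fun h' => h.2.2.1 h'.symm, fun h' => h.2.1 h'.symm,
    fun h' => h.2.2.2 h'.symm⟩

theorem InducedMatchingsAtMost.length_le [Finite V] {p : ℕ} (h : InducedMatchingsAtMost G p)
    {M : List (V × V)} (hM : ∀ q ∈ M, G.Adj q.1 q.2) (hsep : M.Pairwise G.Separated) :
    M.length ≤ p := by
  classical
  have : Std.Symm G.Separated := ⟨fun _ _ h => h.symm⟩
  have hsep' := hsep.forall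
  let H : G.Subgraph := (⊤ : G.Subgraph).induce {x | ∃ q ∈ M, x = q.1 ∨ x = q.2}
  have hH : ∀ x y, H.Adj x y ↔ (∃ q ∈ M, x = q.1 ∨ x = q.2) ∧ (∃ q ∈ M, y = q.1 ∨ y = q.2) ∧
      G.Adj x y := fun x y => by simp [H]
  have hmatch : H.IsMatching := by
    rintro x ⟨q, hq, hx⟩
    have key : ∀ x y, (x = q.1 ∨ x = q.2) → H.Adj x y → y = q.1 ∨ y = q.2 := by
      intro x y hx hxy
      obtain ⟨-, ⟨r, hr, hy⟩, hadj⟩ := (hH x y).1 hxy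
      by_cases hqr : q = r
      · rwa [hqr]
      · obtain ⟨h1, h2, h3, h4⟩ := hsep' hq hr hqr
        rcases hx with rfl | rfl <;> rcases hy with rfl | rfl <;> contradiction
    rcases hx with rfl | rfl
    · refine ⟨q.2, (hH _ _).2 ⟨⟨q, hq, .inl rfl⟩, ⟨q, hq, .inr rfl⟩, hM q hq⟩, fun y hy => ?_⟩
      rcases key _ y (.inl rfl) hy with rfl | rfl
      · exact absurd (H.adj_sub hy) (G.loopless.irrefl _)
      · rfl
    · refine ⟨q.1, (hH _ _).2 ⟨⟨q, hq, .inr rfl⟩, ⟨q, hq, .inl rfl⟩, (hM q hq).symm⟩,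
        fun y hy => ?_⟩
      rcases key _ y (.inr rfl) hy with rfl | rfl
      · rfl
      · exact absurd (H.adj_sub hy) (G.loopless.irrefl _)
  have hind : H.IsInduced := fun x hx y hy hxy => (hH x y).2 ⟨hx, hy, hxy⟩
  have hnodup : (M.map fun q => s(q.1, q.2)).Nodup := by
    refine List.pairwise_map.2 (hsep.imp_of_mem fun {q r} hq hr hqr heq => ?_)
    have hadj := hM q hq
    obtain ⟨h1, h2, h3, h4⟩ := hqr
    rcases Sym2.eq_iff.1 heq with ⟨h5, h6⟩ | ⟨h5, h6⟩
    · exact h2 (h6 ▸ hadj)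
    · exact h1 (h6 ▸ hadj)
  calc M.length = (M.map fun q => s(q.1, q.2)).toFinset.card := by
        rw [List.toFinset_card_of_nodup hnodup, List.length_map]
    _ = ((M.map fun q => s(q.1, q.2)).toFinset : Set (Sym2 V)).ncard :=
        (Set.ncard_coe_finset _).symm
    _ ≤ H.edgeSet.ncard := by
        refine Set.ncard_le_ncard ?_ (Set.toFinite _)
        intro e he
        simp only [List.coe_toFinset, List.mem_map, Set.mem_ofPred_eq] at he
        obtain ⟨q, hq, rfl⟩ := he
        exact (hH _ _).2 ⟨⟨q, hq, .inl rfl⟩, ⟨q, hq, .inr rfl⟩, hM q hq⟩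
    _ ≤ p := h H hmatch hind

/-- Plain greedy choice errs at the vertices whose first neighbour in `S` comes after them. Take
such an erroneous vertex `u` with first neighbour `v` as late as possible. No error occurs from `v`
on, and the pair `(v, u)` rejects every earlier vertex adjacent to `v` or `u`; no earlier element of
`S` is among these. The vertices before `v` that survive form a smaller instance, and its pairs are
separated from `(v, u)`. -/
theorem exists_inducedMatching_of_maximal [LinearOrder V] :
    ∀ (m : ℕ) (X S : Finset V), X.card = m → S ⊆ X → (∀ a ∈ S, ∀ b ∈ S, ¬G.Adj a b) →
      (∀ x ∈ X, x ∉ S → ∃ s ∈ S, G.Adj s x) →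
      ∃ M : List (V × V), (∀ q ∈ M, q.1 ∈ X ∧ q.2 ∈ X ∧ G.Adj q.1 q.2) ∧
        M.Pairwise G.Separated ∧ ∀ w ∈ X, w ∈ S ↔ (∀ w' < w, w' ∈ S → ¬G.Adj w' w) ∧
          ∀ q ∈ M, w < q.1 → ¬G.Adj w q.1 ∧ ¬G.Adj w q.2 := by
  classical
  intro m
  induction m using Nat.strong_induction_on with
  | _ m ih =>
  rintro X S rfl hSX hS hmax
  have hmin : ∀ x ∈ X, x ∉ S → ∃ s ∈ S, G.Adj s x ∧ ∀ s' ∈ S, s' < s → ¬G.Adj s' x := by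
    intro x hx hxS
    obtain ⟨s, hs, hsx⟩ := hmax x hx hxS
    have hne : (S.filter fun s => G.Adj s x).Nonempty := ⟨s, by simp [hs, hsx]⟩
    have h1 := Finset.min'_mem _ hne
    simp only [Finset.mem_filter] at h1
    refine ⟨_, h1.1, h1.2, fun s' hs' hlt hadj => ?_⟩
    exact absurd (Finset.min'_le _ s' (by simp [hs', hadj])) (not_le.2 hlt)
  -- The errors of plain greedy choice, each paired with its first neighbour in `S`.
  let B := (S ×ˢ X).filter fun q => G.Adj q.1 q.2 ∧ q.2 < q.1 ∧ ∀ s ∈ S, s < q.1 → ¬G.Adj s q.2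
  by_cases hB : B.Nonempty
  · obtain ⟨⟨v, u⟩, hvu, hvmax⟩ := B.exists_max_image Prod.fst hB
    simp only [B, Finset.mem_filter, Finset.mem_product] at hvu
    obtain ⟨⟨hvS, huX⟩, hadj, huv, hfirst⟩ := hvu
    let X' := X.filter fun x => x < v ∧ ¬G.Adj x v ∧ ¬G.Adj x u
    have hXmem : ∀ x, x ∈ X' ↔ x ∈ X ∧ x < v ∧ ¬G.Adj x v ∧ ¬G.Adj x u := by simp [X']
    let S' := S.filter fun x => x < v
    have hSmem : ∀ x, x ∈ S' ↔ x ∈ S ∧ x < v := by simp [S']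
    obtain ⟨M, hM, hsep, hiff⟩ := ih X'.card
      (Finset.card_lt_card (Finset.filter_ssubset.2 ⟨v, hSX hvS, by simp⟩)) X' S' rfl
      (by
        intro x hx
        rw [hSmem] at hx
        exact (hXmem x).2 ⟨hSX hx.1, hx.2, hS x hx.1 v hvS, hfirst x hx.1 hx.2⟩)
      (fun a ha b hb => hS a ((hSmem a).1 ha).1 b ((hSmem b).1 hb).1)
      (by
        intro x hx hxS
        rw [hXmem] at hx
        have hxS' : x ∉ S := fun h => hxS ((hSmem x).2 ⟨h, hx.2.1⟩)
        obtain ⟨s, hs, hsx, hsmin⟩ := hmin x hx.1 hxS'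
        refine ⟨s, (hSmem s).2 ⟨hs, ?_⟩, hsx⟩
        rcases lt_or_gt_of_ne hsx.ne with h | h
        · exact h.trans hx.2.1
        · have := hvmax (s, x) (by simp [B, hs, hx.1, hsx, h]; exact hsmin)
          refine lt_of_le_of_ne this ?_
          rintro rfl
          exact hx.2.2.1 hsx.symm)
    refine ⟨(v, u) :: M, ?_, List.pairwise_cons.2 ⟨fun q hq => ?_, hsep⟩, fun w hw => ?_⟩
    · intro q hq
      rcases List.mem_cons.1 hq with rfl | hq
      · exact ⟨hSX hvS, huX, hadj⟩
      · exact ⟨((hXmem _).1 (hM q hq).1).1, ((hXmem _).1 (hM q hq).2.1).1, (hM q hq).2.2⟩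
    · have h1 := (hXmem _).1 (hM q hq).1
      have h2 := (hXmem _).1 (hM q hq).2.1
      exact ⟨fun h => h1.2.2.1 h.symm, fun h => h2.2.2.1 h.symm, fun h => h1.2.2.2 h.symm,
        fun h => h2.2.2.2 h.symm⟩
    · constructor
      · intro hwS
        refine ⟨fun w' _ hw' => hS w' hw' w hwS, fun q hq hlt => ?_⟩
        rcases List.mem_cons.1 hq with rfl | hq
        · exact ⟨hS w hwS v hvS, hfirst w hwS hlt⟩
        · have hwv : w < v := hlt.trans ((hXmem _).1 (hM q hq).1).2.1
          exact ((hiff w ((hXmem w).2 ⟨hw, hwv, hS w hwS v hvS, hfirst w hwS hwv⟩)).1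
            ((hSmem w).2 ⟨hwS, hwv⟩)).2 q hq hlt
      · rintro ⟨h1, h2⟩
        by_contra hwS
        obtain ⟨s, hs, hsw, hsmin⟩ := hmin w hw hwS
        have hws : w < s := by
          rcases lt_or_gt_of_ne hsw.ne with h | h
          · exact absurd hsw (h1 s h hs)
          · exact h
        have hwv : w < v :=
          hws.trans_le (hvmax (s, w) (by simp [B, hs, hw, hsw, hws]; exact hsmin))
        have h3 := h2 (v, u) (by simp) hwv
        refine hwS ((hSmem w).1 ((hiff w ((hXmem w).2 ⟨hw, hwv, h3⟩)).2 ⟨fun w' hw' hm => ?_,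
          fun q hq => h2 q (by simp [hq])⟩)).1
        exact h1 w' hw' ((hSmem w').1 hm).1
  · refine ⟨[], by simp, by simp, fun w hw => ⟨fun hwS => ⟨fun w' _ hw' => hS w' hw' w hwS,
      by simp⟩, fun ⟨h1, _⟩ => ?_⟩⟩
    by_contra hwS
    obtain ⟨s, hs, hsw, hsmin⟩ := hmin w hw hwS
    rcases lt_or_gt_of_ne hsw.ne with h | h
    · exact h1 s h hs hsw
    · exact hB ⟨(s, w), by simp [B, hs, hw, hsw, h]; exact hsmin⟩

/-- The set `T` is obtained by going through the vertices in increasing order and choosing each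
vertex that is outside the closed neighbourhood of `v`, has no neighbour chosen before, and is
adjacent to neither `a j` nor `b j` for all `a j` that come later. -/
def SimpleGraph.IsGreedy [LT V] {p : ℕ} (G : SimpleGraph V) (v : V) (a b : Fin p → V)
    (T : Set V) : Prop :=
  ∀ w, w ∈ T ↔ (w ≠ v ∧ ¬G.Adj w v) ∧ (∀ w' < w, w' ∈ T → ¬G.Adj w' w) ∧
    ∀ j, w < a j → ¬G.Adj w (a j) ∧ ¬G.Adj w (b j)

/-- Membership of `w` refers only to members before `w`, so well-founded induction applies. -/
theorem SimpleGraph.IsGreedy.unique [LinearOrder V] [Finite V] {p : ℕ} {v : V} {a b : Fin p → V}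
    {T T' : Set V} (h : G.IsGreedy v a b T) (h' : G.IsGreedy v a b T') : T = T' := by
  ext w
  induction w using WellFoundedLT.induction with
  | _ w ih =>
  rw [h w, h' w]
  refine and_congr_right fun _ => and_congr_left fun _ => forall₂_congr fun w' hw' => ?_
  rw [ih w' hw']

theorem SimpleGraph.IsGreedy.shields [LinearOrder V] {p : ℕ} {v : V} {a b : Fin p → V}
    {T : Set V} (h : G.IsGreedy v a b T) (hT : ∀ u, G.Adj v u → ∃ t ∈ T, G.Adj t u) :
    G.Shields T v := by
  refine ⟨fun x hx y hy hxy => ?_, fun hv => ((h v).1 hv).1.1 rfl, fun s hs => ((h s).1 hs).1.2, hT⟩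
  rcases lt_or_gt_of_ne hxy.ne with hlt | hlt
  · exact ((h y).1 hy).2.1 x hlt hx hxy
  · exact ((h x).1 hx).2.1 y hlt hy hxy.symm

theorem exists_shields_iff [LinearOrder V] [Fintype V] {p : ℕ} (hG : InducedMatchingsAtMost G p) :
    (∃ S v, G.Shields S v) ↔ ∃ (v : V) (a b : Fin p → V) (T : Set V), G.IsGreedy v a b T ∧
      ∀ u, G.Adj v u → ∃ t ∈ T, G.Adj t u := by
  classical
  refine ⟨?_, fun ⟨v, a, b, T, h, hT⟩ => ⟨T, v, h.shields hT⟩⟩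
  rintro ⟨S₀, v, hS₀⟩
  -- Adding to a shielding set a vertex of `X` with no neighbour in it gives a shielding set again,
  -- so a maximal one is a maximal independent set of `X`.
  obtain ⟨S, hS₀S, hS⟩ := Set.Finite.exists_le_maximal (s := {S : Set V | G.Shields S v})
    (Set.toFinite _) hS₀
  have hSv : G.Shields S v := hS.1
  let X : Finset V := Finset.univ.filter fun w => w ≠ v ∧ ¬G.Adj w v
  obtain ⟨M, hM, hsep, hiff⟩ := exists_inducedMatching_of_maximal (G := G) _ X S.toFinset rfl
    (by
      intro x hx
      have hx : x ∈ S := by simpa using hx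
      simp only [X, Finset.mem_filter, Finset.mem_univ, true_and]
      exact ⟨fun h => hSv.notMem (h ▸ hx), hSv.not_adj x hx⟩)
    (by simpa using hSv.indep)
    (by
      intro x hx hxS
      simp only [X, Finset.mem_filter, Finset.mem_univ, true_and, Set.mem_toFinset] at hx hxS ⊢
      by_contra! hadj
      refine hxS (hS.2 (y := insert x S) ?_ (Set.subset_insert x S) (Set.mem_insert x S))
      refine ⟨?_, ?_, ?_, fun u hu => ?_⟩
      · rintro a (rfl | ha) b (rfl | hb)
        · exact G.loopless.irrefl _
        · exact fun h => hadj b hb h.symm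
        · exact hadj a ha
        · exact hSv.indep a ha b hb
      · rintro (h | h)
        · exact hx.1 h.symm
        · exact hSv.notMem h
      · rintro s (rfl | hs)
        · exact hx.2
        · exact hSv.not_adj s hs
      · obtain ⟨s, hs, hsu⟩ := hSv.dominates u hu
        exact ⟨s, Set.mem_insert_of_mem _ hs, hsu⟩)
  have hlen : M.length ≤ p := hG.length_le (fun q hq => (hM q hq).2.2) hsep
  have : Nonempty V := ⟨v⟩
  -- Padding a short matching with the least vertex is harmless: `w < x₀` never holds, so these
  -- pairs impose no condition.
  obtain ⟨x₀, hx₀⟩ := Finite.exists_min (id : V → V)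
  refine ⟨v, fun j => (M.getD j (x₀, x₀)).1, fun j => (M.getD j (x₀, x₀)).2, S, fun w => ?_,
    hSv.dominates⟩
  have hMj : (∀ j : Fin p, w < (M.getD j (x₀, x₀)).1 → ¬G.Adj w (M.getD j (x₀, x₀)).1 ∧
      ¬G.Adj w (M.getD j (x₀, x₀)).2) ↔ ∀ q ∈ M, w < q.1 → ¬G.Adj w q.1 ∧ ¬G.Adj w q.2 := by
    constructor
    · intro h q hq
      obtain ⟨i, hi, rfl⟩ := List.getElem_of_mem hq
      simpa [hi] using h ⟨i, hi.trans_le hlen⟩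
    · intro h j hlt
      by_cases hj : (j : ℕ) < M.length
      · have := h _ (List.getElem_mem hj)
        simp only [List.getD_eq_getElem _ _ hj] at hlt ⊢
        exact this hlt
      · rw [List.getD_eq_default _ _ (not_lt.1 hj)] at hlt
        exact absurd hlt (not_lt.2 (hx₀ w))
  rw [hMj]
  constructor
  · intro hw
    have hwX : w ≠ v ∧ ¬G.Adj w v := ⟨fun h => hSv.notMem (h ▸ hw), hSv.not_adj w hw⟩
    have := (hiff w (by simp [X, hwX])).1 (by simpa using hw)
    exact ⟨hwX, by simpa using this⟩
  · rintro ⟨hwX, h⟩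
    have := (hiff w (by simp [X, hwX])).2 (by simpa using h)
    simpa using this

end Greedy

/-! ### Stack programs and their compilation to Turing machines. -/

/-- A small imperative language whose memory is a family of stacks of bits. -/
inductive StackProg (K : Type) : Type
  | skip : StackProg K
  | push (k : K) (b : Bool) : StackProg K
  | pop (k : K) : StackProg K
  | ite (c : Option Bool → Bool) (k : K) (p q : StackProg K) : StackProg K
  | seq (p q : StackProg K) : StackProg K
  | loop (c : Option Bool → Bool) (k : K) (p : StackProg K) : StackProg K

namespace StackProg

open Turing

variable {K : Type} [DecidableEq K]

/-- `Exec p s s' t`: the program `p`, started in the memory `s`, ends in the memory `s'` after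
exactly `t` elementary steps. -/
inductive Exec : StackProg K → (K → List Bool) → (K → List Bool) → ℕ → Prop
  | skip (s) : Exec skip s s 1
  | push (k b s) : Exec (push k b) s (Function.update s k (b :: s k)) 1
  | pop (k s) : Exec (pop k) s (Function.update s k (s k).tail) 1
  | ite_true {c k p q s s' t} : c (s k).head? = true → Exec p s s' t →
      Exec (ite c k p q) s s' (t + 1)
  | ite_false {c k p q s s' t} : c (s k).head? = false → Exec q s s' t →
      Exec (ite c k p q) s s' (t + 1)
  | seq {p q s s' s'' t t'} : Exec p s s' t → Exec q s' s'' t' → Exec (seq p q) s s'' (t + t')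
  | loop_done {c k p s} : c (s k).head? = false → Exec (loop c k p) s s 1
  | loop_step {c k p s s' s'' t t'} : c (s k).head? = true → Exec p s s' t →
      Exec (loop c k p) s' s'' t' → Exec (loop c k p) s s'' (t + t' + 1)

/-- The program points of a program. -/
def Label : StackProg K → Type
  | skip => Unit
  | push _ _ => Unit
  | pop _ => Unit
  | ite _ _ p q => Option (Label p ⊕ Label q)
  | seq p q => Label p ⊕ Label q
  | loop _ _ p => Option (Label p)

/-- A program has finitely many program points. -/
@[reducible]
noncomputable def fintypeLabel : (p : StackProg K) → Fintype (Label p)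
  | skip => inferInstanceAs (Fintype Unit)
  | push _ _ => inferInstanceAs (Fintype Unit)
  | pop _ => inferInstanceAs (Fintype Unit)
  | ite _ _ p q =>
    let _ := fintypeLabel p
    let _ := fintypeLabel q
    inferInstanceAs (Fintype (Option (Label p ⊕ Label q)))
  | seq p q =>
    let _ := fintypeLabel p
    let _ := fintypeLabel q
    inferInstanceAs (Fintype (Label p ⊕ Label q))
  | loop _ _ p =>
    let _ := fintypeLabel p
    inferInstanceAs (Fintype (Option (Label p)))

/-- The program point at which a program starts. -/
def entry : (p : StackProg K) → Label p
  | skip => ()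
  | push _ _ => ()
  | pop _ => ()
  | ite _ _ _ _ => none
  | seq p _ => Sum.inl (entry p)
  | loop _ _ _ => none

/-- The statements of a stack machine that executes `p` and then jumps to the label `e`; the
program points of `p` are turned into labels of the machine by `emb`. -/
def code {Λ : Type} : (p : StackProg K) → (Label p → Λ) → Λ → Label p →
    TM2.Stmt (fun _ : K => Bool) Λ (Option Bool)
  | skip, _, e, _ => .goto fun _ => e
  | push k b, _, e, _ => .push k (fun _ => b) (.goto fun _ => e)
  | pop k, _, e, _ => .pop k (fun v _ => v) (.goto fun _ => e)
  | ite c k p q, emb, _, none => .peek k (fun _ o => o) (.branch c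
      (.goto fun _ => emb (some (.inl (entry p)))) (.goto fun _ => emb (some (.inr (entry q)))))
  | ite _ _ p _, emb, e, some (.inl l) => code p (fun l => emb (some (.inl l))) e l
  | ite _ _ _ q, emb, e, some (.inr l) => code q (fun l => emb (some (.inr l))) e l
  | seq p q, emb, _, .inl l => code p (fun l => emb (.inl l)) (emb (.inr (entry q))) l
  | seq _ q, emb, e, .inr l => code q (fun l => emb (.inr l)) e l
  | loop c k p, emb, e, none => .peek k (fun _ o => o) (.branch c
      (.goto fun _ => emb (some (entry p))) (.goto fun _ => e))
  | loop _ _ p, emb, _, some l => code p (fun l => emb (some l)) (emb none) l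

/-- `Steps M t a b`: the stack machine `M` gets from `a` to `b` in exactly `t` steps. -/
def Steps {Λ : Type} (M : Λ → TM2.Stmt (fun _ : K => Bool) Λ (Option Bool)) (t : ℕ)
    (a b : TM2.Cfg (fun _ : K => Bool) Λ (Option Bool)) : Prop :=
  (flip bind (TM2.step M))^[t] (some a) = some b

section Steps

variable {Λ : Type} {M : Λ → TM2.Stmt (fun _ : K => Bool) Λ (Option Bool)}
  {a b c : TM2.Cfg (fun _ : K => Bool) Λ (Option Bool)}

theorem Steps.trans {t t' : ℕ} (h : Steps M t a b) (h' : Steps M t' b c) :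
    Steps M (t + t') a c := by
  unfold Steps at *
  rw [add_comm, Function.iterate_add_apply, h, h']

theorem Steps.single (h : TM2.step M a = some b) : Steps M 1 a b := h

end Steps

/-- The embedding and the exit label are arbitrary so that the induction applies to subprograms
inside larger ones. The final register is left unspecified because every test overwrites it. -/
theorem Exec.steps {Λ : Type} {M : Λ → TM2.Stmt (fun _ : K => Bool) Λ (Option Bool)}
    {p : StackProg K} {s s' : K → List Bool} {t : ℕ} (h : Exec p s s' t) :
    ∀ (emb : Label p → Λ) (e : Λ), (∀ l, M (emb l) = code p emb e l) → ∀ v : Option Bool,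
      ∃ v', Steps M t ⟨some (emb (entry p)), v, s⟩ ⟨some e, v', s'⟩ := by
  induction h with
  | skip s =>
    intro emb e hM v
    exact ⟨v, Steps.single (by simp only [TM2.step, hM, code, TM2.stepAux])⟩
  | push k b s =>
    intro emb e hM v
    exact ⟨v, Steps.single (by simp only [TM2.step, hM, code, TM2.stepAux])⟩
  | pop k s =>
    intro emb e hM v
    exact ⟨v, Steps.single (by simp only [TM2.step, hM, code, TM2.stepAux])⟩
  | @ite_true c k p q s s' t hc _ ih =>
    intro emb e hM v
    obtain ⟨v', h'⟩ := ih (fun l => emb (some (.inl l))) e (fun l => hM _) (s k).head?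
    refine ⟨v', add_comm 1 t ▸ Steps.trans (Steps.single ?_) h'⟩
    refine (congrArg (fun q => some (TM2.stepAux q v s)) (hM (entry (ite c k p q)))).trans ?_
    simp only [code, entry, TM2.stepAux, hc, cond_true]
  | @ite_false c k p q s s' t hc _ ih =>
    intro emb e hM v
    obtain ⟨v', h'⟩ := ih (fun l => emb (some (.inr l))) e (fun l => hM _) (s k).head?
    refine ⟨v', add_comm 1 t ▸ Steps.trans (Steps.single ?_) h'⟩
    refine (congrArg (fun q => some (TM2.stepAux q v s)) (hM (entry (ite c k p q)))).trans ?_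
    simp only [code, entry, TM2.stepAux, hc, cond_false]
  | @seq p q s s' s'' t t' _ _ ih ih' =>
    intro emb e hM v
    obtain ⟨v', h'⟩ := ih (fun l => emb (.inl l)) (emb (.inr (entry q))) (fun l => hM _) v
    obtain ⟨v'', h''⟩ := ih' (fun l => emb (.inr l)) e (fun l => hM _) v'
    exact ⟨v'', h'.trans h''⟩
  | @loop_done c k p s hc =>
    intro emb e hM v
    refine ⟨(s k).head?, Steps.single ?_⟩
    refine (congrArg (fun q => some (TM2.stepAux q v s)) (hM (entry (loop c k p)))).trans ?_
    simp only [code, entry, TM2.stepAux, hc, cond_false]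
  | @loop_step c k p s s' s'' t t' hc _ _ ih ih' =>
    intro emb e hM v
    obtain ⟨v', h'⟩ := ih (fun l => emb (some l)) (emb none) (fun l => hM _) (s k).head?
    obtain ⟨v'', h''⟩ := ih' emb e hM v'
    refine ⟨v'', add_comm 1 (t + t') ▸ Steps.trans (Steps.single ?_) (h'.trans h'')⟩
    refine (congrArg (fun q => some (TM2.stepAux q v s)) (hM (entry (loop c k p)))).trans ?_
    simp only [code, entry, TM2.stepAux, hc, cond_true]

/-- The stack machine of a program, with input stack `i` and output stack `o`. -/
noncomputable def machine [Fintype K] (p : StackProg K) (i o : K) : FinTM2 :=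
  let _ := fintypeLabel p
  { K := K
    k₀ := i
    k₁ := o
    Γ := fun _ => Bool
    Λ := Option (Label p)
    main := some (entry p)
    σ := Option Bool
    initialState := none
    Γk₀Fin := inferInstanceAs (Fintype Bool)
    -- A halting configuration must carry the initial register, so the exit label resets it; this
    -- costs one extra step.
    m := fun l => l.elim (.load (fun _ => none) .halt) (code p some none) }

/-- `Runs p s s' T`: the program `p` gets from `s` to `s'` in at most `T` steps. -/
def Runs (p : StackProg K) (s s' : K → List Bool) (T : ℕ) : Prop := ∃ t ≤ T, Exec p s s' t

theorem initList_eq (tm : FinTM2) (l : List (tm.Γ tm.k₀)) :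
    initList tm l = ⟨some tm.main, tm.initialState, Function.update (fun _ => []) tm.k₀ l⟩ := by
  unfold initList
  congr 1
  funext k
  by_cases hk : k = tm.k₀
  · subst hk; simp
  · simp [hk]

theorem haltList_eq (tm : FinTM2) (l : List (tm.Γ tm.k₁)) :
    haltList tm l = ⟨none, tm.initialState, Function.update (fun _ => []) tm.k₁ l⟩ := by
  unfold haltList
  congr 1
  funext k
  by_cases hk : k = tm.k₁
  · subst hk; simp
  · simp [hk]

/-- A function computed by a program within a polynomial number of steps is computable in
polynomial time. -/
theorem tm2ComputableInPolyTime_of_runs [Fintype K] {α β : Type} {ea : α → List Bool}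
    {eb : β → List Bool} {f : α → β} (p : StackProg K) (i o : K) (T : Polynomial ℕ)
    (h : ∀ a, Runs p (Function.update (fun _ => []) i (ea a))
      (Function.update (fun _ => []) o (eb (f a))) (T.eval (ea a).length)) :
    Nonempty (TM2ComputableInPolyTime ea eb f) := by
  refine ⟨{
    tm := machine p i o
    inputAlphabet := Equiv.refl Bool
    outputAlphabet := Equiv.refl Bool
    time := T + 1
    outputsFun := fun a => Classical.choice ?_ }⟩
  obtain ⟨t, ht, hx⟩ := h a
  obtain ⟨v, hv⟩ := hx.steps (M := (machine p i o).m) some none (fun l => rfl) none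
  refine ⟨⟨⟨t + 1, ?_⟩, by simpa using ht⟩⟩
  have hid : ∀ l : List Bool, l.map (Equiv.refl Bool).invFun = l := fun l => List.map_id l
  rw [Option.map_some]
  erw [initList_eq, haltList_eq, hid, hid]
  exact hv.trans (Steps.single rfl)

end StackProg

/-! ### Time bounds for basic programs. -/

namespace StackProg

section Runs

variable {K : Type} [DecidableEq K]

theorem Runs.mono {p : StackProg K} {s s' : K → List Bool} {T T' : ℕ} (h : Runs p s s' T)
    (hT : T ≤ T') : Runs p s s' T' :=
  let ⟨t, ht, hx⟩ := h
  ⟨t, ht.trans hT, hx⟩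

theorem Runs.of_eq {p : StackProg K} {s s' s'' : K → List Bool} {T T' : ℕ} (h : Runs p s s' T)
    (hs : s'' = s') (hT : T ≤ T') : Runs p s s'' T' := hs ▸ h.mono hT

theorem Runs.skip (s : K → List Bool) : Runs skip s s 1 := ⟨1, le_rfl, .skip s⟩

theorem Runs.push (k : K) (b : Bool) (s : K → List Bool) :
    Runs (push k b) s (Function.update s k (b :: s k)) 1 := ⟨1, le_rfl, .push k b s⟩

theorem Runs.pop (k : K) (s : K → List Bool) :
    Runs (pop k) s (Function.update s k (s k).tail) 1 := ⟨1, le_rfl, .pop k s⟩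

theorem Runs.seq {p q : StackProg K} {s s' s'' : K → List Bool} {T T' : ℕ}
    (h : Runs p s s' T) (h' : Runs q s' s'' T') : Runs (seq p q) s s'' (T + T') :=
  let ⟨_, ht, hx⟩ := h
  let ⟨_, ht', hx'⟩ := h'
  ⟨_, add_le_add ht ht', .seq hx hx'⟩

theorem Runs.ite {p q : StackProg K} {s s' : K → List Bool} {T : ℕ} {c : Option Bool → Bool}
    {k : K} (hp : c (s k).head? = true → Runs p s s' T)
    (hq : c (s k).head? = false → Runs q s s' T) : Runs (ite c k p q) s s' (T + 1) := by
  cases h : c (s k).head? with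
  | true =>
    obtain ⟨t, ht, hx⟩ := hp h
    exact ⟨t + 1, by omega, .ite_true h hx⟩
  | false =>
    obtain ⟨t, ht, hx⟩ := hq h
    exact ⟨t + 1, by omega, .ite_false h hx⟩

theorem Runs.loop {p : StackProg K} {c : Option Bool → Bool} {k : K} {T : ℕ} :
    ∀ (m : ℕ) (f : ℕ → K → List Bool), (∀ j < m, c (f j k).head? = true) →
      c (f m k).head? = false → (∀ j < m, Runs p (f j) (f (j + 1)) T) →
      Runs (loop c k p) (f 0) (f m) (m * (T + 1) + 1)
  | 0, f, _, h, _ => ⟨1, by omega, .loop_done h⟩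
  | m + 1, f, hc, h, hp => by
    obtain ⟨t, ht, hx⟩ := hp 0 (by omega)
    obtain ⟨t', ht', hx'⟩ := Runs.loop m (fun j => f (j + 1)) (fun j hj => hc _ (by omega)) h
      (fun j hj => hp _ (by omega))
    refine ⟨t + t' + 1, ?_, .loop_step (hc 0 (by omega)) hx hx'⟩
    have : (m + 1) * (T + 1) = m * (T + 1) + T + 1 := by ring
    omega

/-- Remove all elements of the stack `k`. -/
def clear (k : K) : StackProg K := .loop Option.isSome k (.pop k)

theorem Runs.clear (k : K) (s : K → List Bool) :
    Runs (clear k) s (Function.update s k []) (2 * (s k).length + 1) := by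
  have h := Runs.loop (p := .pop k) (c := Option.isSome) (k := k) (T := 1) (s k).length
    (fun j => Function.update s k ((s k).drop j)) (fun j hj => by simp [hj])
    (by simp) (fun j hj => by
      have := Runs.pop k (Function.update s k ((s k).drop j))
      simpa using this)
  simp only [List.drop_zero, Function.update_eq_self, List.drop_length] at h
  exact h.mono (by omega)

/-- Move one element, if there is any, from the stack `k` to the stack `k'`. -/
def move (k k' : K) : StackProg K :=
  .ite Option.isNone k .skip (.ite (· == some true) k (.seq (.pop k) (.push k' true))
    (.seq (.pop k) (.push k' false)))

/-- The memory after moving `j` elements from the stack `k` to the stack `k'`. -/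
def moved (k k' : K) (s : K → List Bool) (j : ℕ) : K → List Bool :=
  Function.update (Function.update s k ((s k).drop j)) k' (((s k).take j).reverse ++ s k')

theorem moved_update {k k' l : K} (h : l ≠ k) (h' : l ≠ k') (s : K → List Bool) (j : ℕ)
    (x : List Bool) : moved k k' (Function.update s l x) j = Function.update (moved k k' s j) l x := by
  funext i
  simp only [moved, Function.update_apply]
  split_ifs <;> simp_all

theorem moved_moved {k k' : K} (h : k ≠ k') (s : K → List Bool) (i j : ℕ) :
    moved k k' (moved k k' s i) j = moved k k' s (i + j) := by
  funext l
  simp only [moved, Function.update_apply]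
  split_ifs <;> simp_all [List.take_add]

theorem moved_zero (k k' : K) (s : K → List Bool) : moved k k' s 0 = s := by
  simp [moved]

theorem moved_of_ne {k k' l : K} (h : l ≠ k) (h' : l ≠ k') (s : K → List Bool) (j : ℕ) :
    moved k k' s j l = s l := by
  simp [moved, h, h']

theorem Runs.move {k k' : K} (h : k ≠ k') (s : K → List Bool) :
    Runs (move k k') s (moved k k' s 1) 4 := by
  refine Runs.ite (T := 3) (fun h0 => ?_) (fun h0 => Runs.ite (T := 2) (fun h1 => ?_) (fun h1 => ?_))
  · have : s k = [] := by simpa using h0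
    have h2 : moved k k' s 1 = s := by
      funext l
      simp only [moved, Function.update_apply]
      split_ifs <;> simp_all
    rw [h2]
    exact (Runs.skip s).mono (by omega)
  · have h2 := (Runs.pop k s).seq (Runs.push k' true _)
    convert h2 using 1
    obtain ⟨l, hl⟩ : ∃ l, s k = true :: l := by
      cases hs : s k <;> simp_all
    simp [moved, hl, h.symm]
  · have h2 := (Runs.pop k s).seq (Runs.push k' false _)
    convert h2 using 1
    obtain ⟨l, hl⟩ : ∃ l, s k = false :: l := by
      cases hs : s k <;> simp_all
    simp [moved, hl, h.symm]

/-- Move all elements from the stack `k` to the stack `k'`, reversing their order. -/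
def moveAll (k k' : K) : StackProg K := .loop Option.isSome k (move k k')

theorem Runs.moveAll {k k' : K} (h : k ≠ k') (s : K → List Bool) :
    Runs (moveAll k k') s (Function.update (Function.update s k []) k' ((s k).reverse ++ s k'))
      (5 * (s k).length + 1) := by
  have h := Runs.loop (p := StackProg.move k k') (c := Option.isSome) (k := k) (T := 4) (s k).length
    (fun j => moved k k' s j) (fun j hj => by simp [moved, h, hj])
    (by simp [moved, h]) (fun j hj => by
      have := Runs.move h (moved k k' s j)
      rwa [moved_moved h] at this)
  rw [moved_zero] at h
  simp only [moved, List.drop_length, List.take_length] at h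
  exact h.mono (by omega)

/-- Execute `p` as many times as the stack `k` has elements; the empty stack `c` is used to restore
the stack `k` in the end. -/
def forStk (k c : K) (p : StackProg K) : StackProg K :=
  .seq (.loop Option.isSome k (.seq (.seq (.pop k) (.push c true)) p)) (moveAll c k)

/-- While the body runs, the count is split between `k` and `c`. The body is therefore assumed to
work for all contents `l`, `l'` of these stacks and to preserve them. -/
theorem Runs.forStk {k c : K} (h : k ≠ c) {p : StackProg K} {T : ℕ} (m : ℕ)
    (f : ℕ → K → List Bool) (hk : ∀ j, f j k = List.replicate m true) (hc : ∀ j, f j c = [])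
    (hp : ∀ j < m, ∀ l l', Runs p (Function.update (Function.update (f j) k l) c l')
      (Function.update (Function.update (f (j + 1)) k l) c l') T) :
    Runs (forStk k c p) (f 0) (f m) (m * (T + 8) + 2) := by
  have h1 := Runs.loop (p := .seq (.seq (.pop k) (.push c true)) p) (c := Option.isSome) (k := k)
    (T := T + 2) m
    (fun j => Function.update (Function.update (f j) k (List.replicate (m - j) true)) c
      (List.replicate j true))
    (fun j hj => by
      obtain ⟨d, rfl⟩ : ∃ d, m = j + d + 1 := ⟨m - j - 1, by omega⟩
      simp [h, show j + d + 1 - j = d + 1 by omega, List.replicate_succ])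
    (by simp [h]) (fun j hj => by
      refine (((Runs.pop k _).seq (Runs.push c true _)).seq ?_).mono (by omega : 1 + 1 + T ≤ T + 2)
      convert hp j hj (List.replicate (m - (j + 1)) true) (List.replicate (j + 1) true) using 1
      funext l
      simp only [Function.update_apply]
      split_ifs <;> simp_all [List.replicate_succ, Nat.sub_sub])
  have h2 := h1.seq (Runs.moveAll h.symm _)
  have h3 : f 0 = Function.update (Function.update (f 0) k (List.replicate (m - 0) true)) c
      (List.replicate 0 true) := by
    funext l
    simp only [Function.update_apply]
    split_ifs <;> simp_all
  rw [← h3] at h2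
  refine h2.of_eq ?_ ?_
  · clear h3 h2 h1
    funext l
    simp only [Function.update_apply]
    split_ifs <;> simp [*]
  · simp only [Function.update_self, List.length_replicate]
    have : m * (T + 8) = m * (T + 2 + 1) + 5 * m := by ring
    omega

theorem Runs.forStk_move {k c a b : K} (hkc : k ≠ c) (hab : a ≠ b) (hka : k ≠ a) (hkb : k ≠ b)
    (hca : c ≠ a) (hcb : c ≠ b) (s : K → List Bool) (m : ℕ) (hk : s k = List.replicate m true)
    (hc : s c = []) : Runs (StackProg.forStk k c (StackProg.move a b)) s (moved a b s m) (12 * m + 2) := by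
  have h := Runs.forStk (p := StackProg.move a b) (T := 4) hkc m (fun j => moved a b s j)
    (fun j => by rw [moved_of_ne hka hkb, hk]) (fun j => by rw [moved_of_ne hca hcb, hc])
    (fun j hj l l' => by
      rw [← moved_update hka hkb, ← moved_update hca hcb, ← moved_update hka hkb,
        ← moved_update hca hcb, ← moved_moved hab]
      exact Runs.move hab _)
  rw [moved_zero] at h
  exact h.mono (by omega)

end Runs

/-! ### Polynomial-time evaluation of properties of a store. -/

/-- The stacks used to evaluate a first-order property of a graph and a list of bits. -/
inductive Stk (ι : Type) : Type
  | mat | mat' | cnt | set | set' | res | aux | aux'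
  | val (i : ι)
  | rem (i : ι)
  deriving DecidableEq, Fintype

/-- A square matrix of bits of size `n`, a list `set` of bits, and the values of variables;
`rem i` is the number of values that a loop over the variable `i` has not yet reached. -/
structure Store (ι : Type) where
  n : ℕ
  mat : List Bool
  set : List Bool
  env : ι → ℕ
  rem : ι → ℕ

namespace Store

variable {ι : Type} [DecidableEq ι]

/-- The memory that represents a store, and a stack of results. -/
def mem (st : Store ι) (res : List Bool) : Stk ι → List Bool
  | .mat => st.mat
  | .mat' => []
  | .cnt => List.replicate st.n true
  | .set => st.set
  | .set' => []
  | .res => res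
  | .aux => []
  | .aux' => []
  | .val i => List.replicate (st.env i) true
  | .rem i => List.replicate (st.rem i) true

/-- Set the value of a variable. -/
def assign (st : Store ι) (i : ι) (x r : ℕ) : Store ι :=
  { st with env := Function.update st.env i x, rem := Function.update st.rem i r }

/-- The size bounds that a store satisfies. -/
structure Good (st : Store ι) : Prop where
  mat : st.mat.length ≤ st.n * st.n
  set : st.set.length ≤ st.n
  env : ∀ i, st.env i ≤ st.n

/-- The entry of the matrix in row `x` and column `y` is true. -/
def Adj (st : Store ι) (x y : ℕ) : Prop := st.mat[x * st.n + y]? = some true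

/-- The list of bits, read from its end, is true at place `x`. -/
def Mem (st : Store ι) (x : ℕ) : Prop := st.set.reverse[x]? = some true

end Store

/-- On the stores satisfying `Q`, the property `P` is evaluated by a program that runs in
polynomial time. -/
def Comp {ι : Type} [DecidableEq ι] (Q P : Store ι → Prop) : Prop :=
  ∃ (p : StackProg (Stk ι)) (T : Polynomial ℕ), ∀ st res b, st.Good → Q st → (b = true ↔ P st) →
    Runs p (st.mem res) (st.mem (b :: res)) (T.eval st.n)

section Comp

variable {ι : Type} [DecidableEq ι] {Q P P' : Store ι → Prop}

theorem Comp.imp {Q' : Store ι → Prop} (h : Comp Q P) (hQ : ∀ st, Q' st → Q st) : Comp Q' P :=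
  let ⟨p, T, hp⟩ := h
  ⟨p, T, fun st res b hg hst => hp st res b hg (hQ st hst)⟩

theorem Comp.congr (h : Comp Q P) (hP : ∀ st, Q st → (P st ↔ P' st)) : Comp Q P' :=
  let ⟨p, T, hp⟩ := h
  ⟨p, T, fun st res b hg hst hb => hp st res b hg hst (hb.trans (hP st hst).symm)⟩

theorem Comp.trivial : Comp Q fun _ => True :=
  ⟨.push .res true, 1, fun st res b _ _ hb => by
    refine (Runs.push (Stk.res (ι := ι)) true (st.mem res)).of_eq ?_ (by simp)
    funext k; cases k <;> simp [Store.mem, hb]⟩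

/-- Replace the top result by its negation. -/
def notTop : StackProg (Stk ι) :=
  .ite (· == some true) .res (.seq (.pop .res) (.push .res false))
    (.seq (.pop .res) (.push .res true))

theorem Runs.notTop (st : Store ι) (b : Bool) (res : List Bool) :
    Runs notTop (st.mem (b :: res)) (st.mem ((!b) :: res)) 3 := by
  refine Runs.ite (T := 2) (fun h => ?_) (fun h => ?_)
  · have : b = true := by simpa [Store.mem] using h
    refine ((Runs.pop _ _).seq (Runs.push _ _ _)).of_eq ?_ le_rfl
    funext k; cases k <;> simp [Store.mem, this]
  · have : b = false := by simpa [Store.mem] using h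
    refine ((Runs.pop _ _).seq (Runs.push _ _ _)).of_eq ?_ le_rfl
    funext k; cases k <;> simp [Store.mem, this]

theorem Comp.not (h : Comp Q P) : Comp Q fun st => ¬P st := by
  obtain ⟨p, T, hp⟩ := h
  refine ⟨.seq p notTop, T + 3, fun st res b hg hst hb => ?_⟩
  have := (hp st res (!b) hg hst (by simp [← Bool.not_eq_true, hb])).seq (Runs.notTop _ _ _)
  simpa using this

/-- Replace the two top results by their conjunction. -/
def andTop : StackProg (Stk ι) :=
  .ite (· == some true) .res (.pop .res) (.seq (.pop .res) (.seq (.pop .res) (.push .res false)))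

theorem Runs.andTop (st : Store ι) (b b' : Bool) (res : List Bool) :
    Runs andTop (st.mem (b' :: b :: res)) (st.mem ((b && b') :: res)) 4 := by
  refine Runs.ite (T := 3) (fun h => ?_) (fun h => ?_)
  · have : b' = true := by simpa [Store.mem] using h
    refine (Runs.pop _ _).of_eq ?_ (by omega)
    funext k; cases k <;> simp [Store.mem, this]
  · have : b' = false := by simpa [Store.mem] using h
    refine ((Runs.pop _ _).seq ((Runs.pop _ _).seq (Runs.push _ _ _))).of_eq ?_ (by omega)
    funext k; cases k <;> simp [Store.mem, this]

theorem Comp.and (h : Comp Q P) (h' : Comp Q P') : Comp Q fun st => P st ∧ P' st := by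
  classical
  obtain ⟨p, T, hp⟩ := h
  obtain ⟨p', T', hp'⟩ := h'
  refine ⟨.seq p (.seq p' andTop), T + (T' + 4), fun st res b hg hst hb => ?_⟩
  have hbb : b = (decide (P st) && decide (P' st)) := by
    rw [Bool.eq_iff_iff]; simp [hb]
  have := (hp st res _ hg hst decide_eq_true_iff).seq
    ((hp' st _ _ hg hst decide_eq_true_iff).seq (Runs.andTop st _ _ _))
  simpa [hbb] using this

theorem Comp.list_all {α : Type} (l : List α) {R : α → Store ι → Prop}
    (h : ∀ a ∈ l, Comp Q (R a)) : Comp Q fun st => ∀ a ∈ l, R a st := by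
  induction l with
  | nil => simpa using Comp.trivial
  | cons a l ih => simpa using (h a (by simp)).and (ih fun b hb => h b (by simp [hb]))

theorem Comp.imp_right (h : Comp Q P) (h' : Comp Q P') : Comp Q fun st => P st → P' st :=
  (h.and h'.not).not.congr fun st _ => by tauto

/-- Put on the stack of results whether the top of the stack `k` satisfies `c`. -/
def test (c : Option Bool → Bool) (k : Stk ι) : StackProg (Stk ι) :=
  .ite c k (.push .res true) (.push .res false)

theorem Runs.test (c : Option Bool → Bool) (k : Stk ι) (s : Stk ι → List Bool) :
    Runs (test c k) s (Function.update s .res (c (s k).head? :: s .res)) 2 :=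
  Runs.ite (T := 1) (fun h => h ▸ Runs.push _ _ _) (fun h => h ▸ Runs.push _ _ _)

/-- Remove `env i` elements from the stack of `j`, stopping harmlessly if it runs empty; something
remains iff the inequality is strict. -/
theorem Comp.lt {i j : ι} (hij : i ≠ j) : Comp Q fun st => st.env i < st.env j := by
  refine ⟨.seq (forStk (.val i) .aux (move (.val j) .aux')) (.seq (test Option.isSome (.val j))
    (moveAll .aux' (.val j))), 17 * Polynomial.X + 5, fun st res b hg _ hb => ?_⟩
  have h := (Runs.forStk_move (k := Stk.val i) (c := .aux) (a := .val j) (b := .aux') (by simp)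
    (by simp) (by simp [hij]) (by simp) (by simp) (by simp) (st.mem res) (st.env i) rfl rfl).seq
    ((Runs.test Option.isSome (.val j) _).seq
    (Runs.moveAll (k := .aux') (k' := .val j) (by simp) _))
  refine h.of_eq ?_ ?_
  · funext k
    cases k with
    | res =>
      have : b = (List.replicate (st.env j - st.env i) true).head?.isSome := by
        rw [Bool.eq_iff_iff, hb]
        simp [List.head?_replicate, Nat.sub_eq_zero_iff_le]
      simp [Store.mem, moved, this]
    | val i' =>
      by_cases h : i' = j
      · subst h
        simp only [Store.mem, moved, Function.update_apply]
        simp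
        omega
      · simp [Store.mem, moved, h]
    | _ => simp [Store.mem, moved]
  · have h1 := hg.env i
    have h2 := hg.env j
    simp [moved, Store.mem]
    omega

theorem Comp.mem (i : ι) : Comp Q fun st => st.Mem (st.env i) := by
  refine ⟨.seq (moveAll .set .set') (.seq (forStk (.val i) .aux (move .set' .set))
    (.seq (test (· == some true) .set') (moveAll .set' .set))), 22 * Polynomial.X + 6,
    fun st res b hg _ hb => ?_⟩
  have h := (Runs.moveAll (k := Stk.set (ι := ι)) (k' := .set') (by simp) (st.mem res)).seq
    ((Runs.forStk_move (k := Stk.val i) (c := .aux) (a := .set') (b := .set) (by simp) (by simp)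
    (by simp) (by simp) (by simp) (by simp) _ (st.env i) (by simp [Store.mem])
    (by simp [Store.mem])).seq
    ((Runs.test (· == some true) .set' _).seq
    (Runs.moveAll (k := .set') (k' := .set) (by simp) _)))
  refine h.of_eq ?_ ?_
  · funext k
    cases k with
    | res =>
      have : b = ((st.set.reverse.drop (st.env i)).head? == some true) := by
        rw [Bool.eq_iff_iff, hb]
        simp [Store.Mem]
      simp [Store.mem, moved, this]
    | set =>
      simp [Store.mem, moved, ← List.reverse_append]
    | _ => simp [Store.mem, moved]
  · have h1 := hg.env i
    have h2 := hg.set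
    simp [moved, Store.mem]
    omega

/-- The entry is found by skipping `env i` rows of length `n` and then `env j` bits; the skipped
bits are afterwards moved back. -/
theorem Comp.adj (i j : ι) : Comp Q fun st => st.Adj (st.env i) (st.env j) := by
  refine ⟨.seq (forStk (.val i) .aux (forStk .cnt .aux' (move .mat .mat')))
    (.seq (forStk (.val j) .aux (move .mat .mat'))
    (.seq (test (· == some true) .mat) (moveAll .mat' .mat))),
    17 * Polynomial.X ^ 2 + 22 * Polynomial.X + 7, fun st res b hg _ hb => ?_⟩
  have hrow := Runs.forStk (k := Stk.val i) (c := .aux)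
    (p := forStk .cnt .aux' (StackProg.move .mat .mat')) (T := 12 * st.n + 2) (by simp) (st.env i)
    (fun x => moved .mat .mat' (st.mem res) (x * st.n)) (fun x => by simp [moved, Store.mem])
    (fun x => by simp [moved, Store.mem]) (fun x hx l l' => by
      have := Runs.forStk_move (k := Stk.cnt) (c := .aux') (a := .mat) (b := .mat') (by simp)
        (by simp) (by simp) (by simp) (by simp) (by simp) (Function.update (Function.update
        (moved .mat .mat' (st.mem res) (x * st.n)) (.val i) l) .aux l') st.n
        (by simp [moved, Store.mem]) (by simp [moved, Store.mem])
      rwa [moved_update (by simp) (by simp), moved_update (by simp) (by simp),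
        moved_moved (by simp), ← Nat.succ_mul] at this)
  simp only [zero_mul, moved_zero] at hrow
  have hcol := Runs.forStk_move (k := Stk.val j) (c := .aux) (a := .mat) (b := .mat') (by simp)
    (by simp) (by simp) (by simp) (by simp) (by simp)
    (moved .mat .mat' (st.mem res) (st.env i * st.n)) (st.env j) (by simp [moved, Store.mem])
    (by simp [moved, Store.mem])
  rw [moved_moved (by simp)] at hcol
  have h := hrow.seq (hcol.seq ((Runs.test (· == some true) .mat _).seq
    (Runs.moveAll (k := .mat') (k' := .mat) (by simp) _)))
  refine h.of_eq ?_ ?_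
  · funext k
    cases k with
    | res =>
      have : b = ((st.mat.drop (st.env i * st.n + st.env j)).head? == some true) := by
        rw [Bool.eq_iff_iff, hb]
        simp [Store.Adj]
      simp [Store.mem, moved, this]
    | mat => simp [Store.mem, moved]
    | _ => simp [Store.mem, moved]
  · have h1 := hg.env i
    have h2 := hg.env j
    have h3 := hg.mat
    simp [moved, Store.mem]
    have h4 : min (st.env i * st.n + st.env j) st.mat.length ≤ st.n * st.n :=
      (min_le_right _ _).trans h3
    have h5 : st.env i * (12 * st.n + 2 + 8) ≤ st.n * (12 * st.n + 2 + 8) :=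
      Nat.mul_le_mul_right _ h1
    nlinarith

/-- Execute `p` for all values of the variable `i`. -/
def forVar (i : ι) (p : StackProg (Stk ι)) : StackProg (Stk ι) :=
  .seq (forStk .cnt .aux (.push (.rem i) true))
    (.seq (.loop Option.isSome (.rem i) (.seq (.pop (.rem i)) (.seq p (.push (.val i) true))))
      (clear (.val i)))

/-- In round `j` one element has just left `rem i` and `val i` has not yet grown, so the body sees
the value `j` and `n - (j + 1)` remaining ones. The family `st` describes what the body changes
besides the loop variable. -/
theorem Runs.forVar (i : ι) {p : StackProg (Stk ι)} {T n : ℕ} (st : ℕ → Store ι)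
    (res : ℕ → List Bool) (hn : ∀ j, (st j).n = n) (hi : ∀ j, (st j).env i = 0)
    (hi' : ∀ j, (st j).rem i = 0)
    (hp : ∀ j < n, Runs p (((st j).assign i j (n - (j + 1))).mem (res j))
      (((st (j + 1)).assign i j (n - (j + 1))).mem (res (j + 1))) T) :
    Runs (forVar i p) ((st 0).mem (res 0)) ((st n).mem (res n)) (n * (T + 14) + 4) := by
  have h1 := Runs.forStk (k := Stk.cnt) (c := .aux) (p := .push (.rem i) true) (T := 1) (by simp) n
    (fun j => Function.update ((st 0).mem (res 0)) (.rem i) (List.replicate j true))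
    (fun j => by simp [Store.mem, hn]) (fun j => by simp [Store.mem]) (fun j hj l l' => by
      refine (Runs.push _ _ _).of_eq ?_ le_rfl
      funext k
      simp only [Function.update_apply]
      split_ifs <;> simp_all [List.replicate_succ])
  have h2 := Runs.loop (c := Option.isSome) (k := Stk.rem i)
    (p := .seq (.pop (.rem i)) (.seq p (.push (.val i) true))) (T := T + 2) n
    (fun j => ((st j).assign i j (n - j)).mem (res j))
    (fun j hj => by
      simp [Store.mem, Store.assign, Option.isSome_iff_ne_none, Nat.sub_eq_zero_iff_le]
      omega)
    (by simp [Store.mem, Store.assign]) (fun j hj => by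
      have h3 : Runs (.pop (.rem i)) (((st j).assign i j (n - j)).mem (res j))
          (((st j).assign i j (n - (j + 1))).mem (res j)) 1 := by
        refine (Runs.pop _ _).of_eq ?_ le_rfl
        funext k
        cases k <;> simp [Store.mem, Store.assign, Function.update_apply]
        split_ifs <;> simp [Nat.sub_sub]
      refine (h3.seq ((hp j hj).seq (Runs.push (.val i) true _))).of_eq ?_ ?_
      · funext k
        cases k <;> simp [Store.mem, Store.assign, Function.update_apply]
        split_ifs <;> simp [List.replicate_succ]
      · omega)
  have h3 := Runs.clear (.val i) (((st n).assign i n (n - n)).mem (res n))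
  have h4 : Function.update ((st 0).mem (res 0)) (.rem i) (List.replicate n true) =
      ((st 0).assign i 0 (n - 0)).mem (res 0) := by
    funext k
    cases k <;> simp [Store.mem, Store.assign, Function.update_apply]
    · rintro rfl
      exact hi 0
    · split_ifs <;> simp
  simp only [h4] at h1
  have h5 : Function.update ((st 0).mem (res 0)) (.rem i) (List.replicate 0 true) =
      (st 0).mem (res 0) := by
    simp [Store.mem, hi']
  rw [h5] at h1
  refine (h1.seq (h2.seq h3)).of_eq ?_ ?_
  · funext k
    cases k <;> simp [Store.mem, Store.assign, Function.update_apply]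
    · split_ifs with h <;> simp [*]
    · rintro rfl
      exact hi' n
  · simp [Store.mem, Store.assign]
    ring_nf
    omega

theorem Comp.ex {i : ι} {Q' : Store ι → Prop} (h : Comp Q P)
    (hi : ∀ st, Q' st → st.env i = 0 ∧ st.rem i = 0)
    (hQ : ∀ st, Q' st → ∀ x r, Q (st.assign i x r)) :
    Comp Q' fun st => ∃ x < st.n, P (st.assign i x (st.n - (x + 1))) := by
  classical
  obtain ⟨p, T, hp⟩ := h
  refine ⟨.seq (.push .res true) (.seq (forVar i (.seq p (.seq notTop andTop))) notTop),
    Polynomial.X * (T + 21) + 8, fun st res b hg hst hb => ?_⟩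
  -- The accumulated bit says that no value so far satisfies `P`; it is negated after the loop.
  have h1 := Runs.forVar i (p := .seq p (.seq notTop andTop)) (n := st.n) (T := T.eval st.n + 7)
    (fun _ => st) (fun j => decide (∀ x < j, ¬P (st.assign i x (st.n - (x + 1)))) :: res)
    (fun _ => rfl) (fun _ => (hi st hst).1) (fun _ => (hi st hst).2) (fun j hj => by
      have := (hp (st.assign i j (st.n - (j + 1)))
        (decide (∀ x < j, ¬P (st.assign i x (st.n - (x + 1)))) :: res) _
        ⟨hg.mat, hg.set, fun l => by
          by_cases hl : l = i
          · subst hl; simpa [Store.assign] using hj.le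
          · simpa [Store.assign, hl] using hg.env l⟩ (hQ st hst _ _) decide_eq_true_iff).seq
        ((Runs.notTop _ _ _).seq (Runs.andTop _ _ _ _))
      refine this.of_eq ?_ le_rfl
      congr 2
      rw [Bool.eq_iff_iff]
      simp only [Bool.and_eq_true, Bool.not_eq_true', decide_eq_false_iff_not, decide_eq_true_iff,
        Nat.lt_succ_iff_lt_or_eq, or_imp, forall_and, forall_eq])
  have h0 : Runs (.push .res true) (st.mem res)
      (st.mem (decide (∀ x < 0, ¬P (st.assign i x (st.n - (x + 1)))) :: res)) 1 := by
    refine (Runs.push _ _ _).of_eq ?_ le_rfl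
    funext k; cases k <;> simp [Store.mem]
  refine (h0.seq (h1.seq (Runs.notTop _ _ _))).of_eq ?_ ?_
  · congr 2
    rw [Bool.eq_iff_iff, hb]
    simp
  · simp
    ring_nf
    omega

/-- The property that `P` holds for some values of the variables in the list. -/
def Exs (P : Store ι → Prop) : List ι → Store ι → Prop
  | [], st => P st
  | i :: l, st => ∃ x < st.n, Exs P l (st.assign i x (st.n - (x + 1)))

/-- `Z` holds the variables that must still be zero when the evaluation of `P` starts, such as those
it loops over itself. -/
theorem Comp.exs (l : List ι) (hl : l.Nodup) (Z : Set ι) (hZ : ∀ i ∈ l, i ∉ Z)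
    (h : Comp (fun st => st.set = [] ∧ ∀ i ∈ Z, st.env i = 0 ∧ st.rem i = 0) P) :
    Comp (fun st => st.set = [] ∧ ∀ i, i ∈ Z ∨ i ∈ l → st.env i = 0 ∧ st.rem i = 0) (Exs P l) := by
  induction l with
  | nil => exact (show Comp _ P from h.imp fun st hst => by simpa using hst)
  | cons i l ih =>
    obtain ⟨hi, hl⟩ := List.nodup_cons.1 hl
    refine Comp.ex (ih hl fun j hj => hZ j (by simp [hj])) (fun st hst => hst.2 i (by simp))
      fun st hst x r => ⟨hst.1, fun j hj => ?_⟩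
    have hji : j ≠ i := by
      rintro rfl
      exact hj.elim (hZ j (by simp)) hi
    simpa [Store.assign, hji] using hst.2 j (by simp; tauto)

open Classical in
/-- The list of bits obtained by appending, for all values `x < j` of the variable `i` in increasing
order, the truth value of `P`. -/
noncomputable def iterSet (P : Store ι → Prop) (i : ι) (st : Store ι) : ℕ → List Bool
  | 0 => []
  | j + 1 => decide (P ({ st with set := iterSet P i st j }.assign i j (st.n - (j + 1)))) ::
      iterSet P i st j

theorem length_iterSet (P : Store ι → Prop) (i : ι) (st : Store ι) (j : ℕ) :
    (iterSet P i st j).length = j := by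
  induction j with
  | zero => rfl
  | succ j ih => simp [iterSet, ih]

/-- Each bit computed for `P` is moved from `res` onto `set`, so the next evaluation sees all
earlier decisions. Clearing `set` at the end restores the memory, since it was empty at the start.
-/
theorem Comp.iterate {i : ι} {Q' : Store ι → Prop} (h : Comp Q P) (h' : Comp Q P')
    (hi : ∀ st, Q' st → st.set = [] ∧ st.env i = 0 ∧ st.rem i = 0)
    (hQ : ∀ st, Q' st → ∀ l x r, Q ({ st with set := l }.assign i x r))
    (hQ' : ∀ st, Q' st → ∀ l, Q { st with set := l }) :
    Comp Q' fun st => P' { st with set := iterSet P i st st.n } := by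
  classical
  obtain ⟨p, T, hp⟩ := h
  obtain ⟨p', T', hp'⟩ := h'
  refine ⟨.seq (forVar i (.seq p (move .res .set))) (.seq p' (clear .set)),
    Polynomial.X * (T + 20) + T' + 5, fun st res b hg hst hb => ?_⟩
  have h1 := Runs.forVar i (p := .seq p (move .res .set)) (n := st.n) (T := T.eval st.n + 4)
    (fun j => { st with set := iterSet P i st j }) (fun _ => res)
    (fun _ => rfl) (fun _ => (hi st hst).2.1) (fun _ => (hi st hst).2.2) (fun j hj => by
      have := (hp ({ st with set := iterSet P i st j }.assign i j (st.n - (j + 1))) res _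
        ⟨hg.mat, by simpa [Store.assign, length_iterSet] using hj.le, fun l => by
          by_cases hl : l = i
          · subst hl; simpa [Store.assign] using hj.le
          · simpa [Store.assign, hl] using hg.env l⟩ (hQ st hst _ _ _) decide_eq_true_iff).seq
        (Runs.move (k := .res) (k' := .set) (by simp) _)
      refine this.of_eq ?_ le_rfl
      funext k
      cases k <;> simp [moved, Store.mem, Store.assign, iterSet])
  have h2 := (hp' { st with set := iterSet P i st st.n } res b
    ⟨hg.mat, by simp [length_iterSet], hg.env⟩ (hQ' st hst _) hb).seq (Runs.clear .set _)
  have h3 : { st with set := iterSet P i st 0 } = st := by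
    simp [iterSet, ← (hi st hst).1]
  simp only [h3] at h1
  refine (h1.seq h2).of_eq ?_ ?_
  · funext k
    cases k <;> simp [Store.mem, (hi st hst).1]
  · simp [Store.mem, length_iterSet]
    ring_nf
    omega

end Comp

end StackProg

/-! ### Reading the input graph and interpreting stores. -/

namespace StackProg

theorem eval_mono_nat (T : Polynomial ℕ) {m n : ℕ} (h : m ≤ n) : T.eval m ≤ T.eval n := by
  simp only [Polynomial.eval_eq_sum, Polynomial.sum]
  exact Finset.sum_le_sum fun i _ => by gcongr

theorem getElem?_flatMap {α : Type} (f : α → List Bool) (n : ℕ) (hf : ∀ a, (f a).length = n)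
    (l : List α) (x y : ℕ) (hx : x < l.length) (hy : y < n) :
    (l.flatMap f)[x * n + y]? = (f l[x])[y]? := by
  induction l generalizing x with
  | nil => simp at hx
  | cons a l ih =>
    rw [List.flatMap_cons]
    cases x with
    | zero =>
      rw [List.getElem?_append_left (by rw [hf]; omega)]
      simp
    | succ x =>
      rw [List.getElem?_append_right (by rw [hf, Nat.succ_mul]; omega), hf]
      rw [show (x + 1) * n + y - n = x * n + y by rw [Nat.succ_mul]; omega]
      exact ih x (by simpa using hx)

open Classical in
/-- The store that holds a graph. -/
noncomputable def graphStore (ι : Type) (G : FiniteGraph) : Store ι where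
  n := G.1
  mat := (List.finRange G.1).flatMap fun i => (List.finRange G.1).map fun j => decide (G.2.Adj i j)
  set := []
  env := fun _ => 0
  rem := fun _ => 0

section

variable {ι : Type}

theorem graphStore_mat_length (G : FiniteGraph) : (graphStore ι G).mat.length = G.1 * G.1 := by
  simp [graphStore, List.length_flatMap]

/-- The bound on values in `Good` is weak so that it also holds for the empty graph, where all
variables are `0 = n`. -/
theorem graphStore_good (G : FiniteGraph) : (graphStore ι G).Good :=
  ⟨(graphStore_mat_length G).le, by simp [graphStore], by simp [graphStore]⟩

theorem encodeGraph_eq (G : FiniteGraph) :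
    encodeGraph G = List.replicate G.1 true ++ false :: (graphStore ι G).mat := rfl

theorem adj_of_mat_eq {st : Store ι} {G : FiniteGraph} (hmat : st.mat = (graphStore ι G).mat)
    (hn : st.n = G.1) (x y : Fin G.1) : st.Adj x y ↔ G.2.Adj x y := by
  unfold Store.Adj
  rw [hmat, hn]
  unfold graphStore
  rw [getElem?_flatMap _ G.1 (by simp) _ _ _ (by simp) y.2]
  simp

/-- A property of graphs that can be evaluated on the stores that hold them is decided in polynomial
time. -/
theorem decidableInPolyTimeOn_of_comp [Fintype ι] [DecidableEq ι] {P : Store ι → Prop}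
    (h : Comp (fun st => st.set = [] ∧ ∀ i, st.env i = 0 ∧ st.rem i = 0) P)
    (S R : FiniteGraph → Prop) (hR : ∀ G, S G → (R G ↔ P (graphStore ι G))) :
    DecidableInPolyTimeOn encodeGraph S R := by
  classical
  obtain ⟨p, T, hp⟩ := h
  -- The input is placed on the stack `mat` itself: its unary prefix is moved to `cnt` and the
  -- separating bit dropped, which leaves exactly the store of the graph.
  refine tm2ComputableInPolyTime_of_runs
    (.seq (.loop (· == some true) .mat (.seq (.pop .mat) (.push .cnt true))) (.seq (.pop .mat)
      (.seq p (.seq (clear .mat) (clear .cnt))))) (.mat : Stk ι) .res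
    (T + 2 * Polynomial.X ^ 2 + 5 * Polynomial.X + 4) fun ⟨G, hG⟩ => ?_
  have h1 := Runs.loop (c := (· == some true)) (k := (.mat : Stk ι))
    (p := .seq (.pop .mat) (.push .cnt true)) (T := 2) G.1
    (fun j => Function.update (Function.update (fun _ => []) .mat
      (List.replicate (G.1 - j) true ++ false :: (graphStore ι G).mat)) .cnt
      (List.replicate j true))
    (fun j hj => by
      obtain ⟨d, hd⟩ : ∃ d, G.1 - j = d + 1 := ⟨G.1 - j - 1, by omega⟩
      simp [hd, List.replicate_succ])
    (by simp) (fun j hj => by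
      refine ((Runs.pop _ _).seq (Runs.push _ _ _)).of_eq ?_ le_rfl
      obtain ⟨d, hd⟩ : ∃ d, G.1 - j = d + 1 := ⟨G.1 - j - 1, by omega⟩
      have hd' : G.1 - (j + 1) = d := by omega
      funext k
      simp only [Function.update_apply, hd, hd']
      split_ifs <;> simp_all [List.replicate_succ])
  have h0 : Function.update (Function.update (fun _ => []) .mat
      (List.replicate (G.1 - 0) true ++ false :: (graphStore ι G).mat)) .cnt
      (List.replicate 0 true) = Function.update (fun _ => []) (.mat : Stk ι) (encodeGraph G) := by
    funext k
    simp only [Function.update_apply, encodeGraph_eq (ι := ι)]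
    split_ifs <;> simp_all
  simp only [h0] at h1
  have h2 : Runs (StackProg.pop Stk.mat) _ ((graphStore ι G).mem []) 1 :=
    (Runs.pop Stk.mat (Function.update (Function.update (fun _ => []) Stk.mat
      (List.replicate (G.1 - G.1) true ++ false :: (graphStore ι G).mat)) Stk.cnt
      (List.replicate G.1 true))).of_eq (by
        funext k
        cases k <;> simp [Store.mem]
        all_goals simp [graphStore]) le_rfl
  have h3 := hp (graphStore ι G) [] (decide (R G)) (graphStore_good G)
    ⟨rfl, fun _ => ⟨rfl, rfl⟩⟩ (by simpa using hR G hG)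
  have h4 := h1.seq (h2.seq (h3.seq ((Runs.clear .mat _).seq (Runs.clear .cnt _))))
  refine h4.of_eq ?_ ?_
  · funext k
    cases k <;> simp [Store.mem, Computability.encodeBool, graphStore]
  · have hlen : G.1 ≤ (encodeGraph G).length := by simp [encodeGraph]
    have hT := eval_mono_nat T hlen
    have hmat : ((graphStore ι G).mem [decide (R G)] .mat).length = G.1 * G.1 :=
      graphStore_mat_length G
    have hcnt : (Function.update ((graphStore ι G).mem [decide (R G)]) .mat [] .cnt).length =
        G.1 := by simp [Store.mem, graphStore]
    rw [hmat, hcnt]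
    simp only [graphStore, Polynomial.eval_add, Polynomial.eval_mul, Polynomial.eval_pow,
      Polynomial.eval_X, Polynomial.eval_ofNat] at hT ⊢
    nlinarith [Nat.mul_le_mul hlen hlen]

end

namespace Store

variable {ι : Type} [DecidableEq ι]

@[simp]
theorem assign_n (st : Store ι) (i : ι) (x r : ℕ) : (st.assign i x r).n = st.n := rfl

@[simp]
theorem assign_env (st : Store ι) (i : ι) (x r : ℕ) :
    (st.assign i x r).env = Function.update st.env i x := rfl

@[simp]
theorem assign_rem (st : Store ι) (i : ι) (x r : ℕ) :
    (st.assign i x r).rem = Function.update st.rem i r := rfl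

@[simp]
theorem assign_adj (st : Store ι) (i : ι) (x r : ℕ) : (st.assign i x r).Adj = st.Adj := rfl

@[simp]
theorem assign_Mem (st : Store ι) (i : ι) (x r : ℕ) : (st.assign i x r).Mem = st.Mem := rfl

end Store

section

variable {ι : Type} [DecidableEq ι]

theorem exs_iff {P : Store ι → Prop} {R : (ι → ℕ) → Prop} {n : ℕ} {mat : List Bool} {L : List ι}
    (hP : ∀ st : Store ι, st.n = n → st.mat = mat → st.set = [] → (∀ i ∈ L, st.env i < n) →
      (P st ↔ R st.env)) (l : List ι) (st : Store ι) (hn : st.n = n) (hmat : st.mat = mat)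
    (hset : st.set = []) (hL : ∀ i ∈ L, i ∉ l → st.env i < n) :
    Exs P l st ↔ ∃ f : ι → ℕ, (∀ i ∈ l, f i < n) ∧ (∀ i ∉ l, f i = st.env i) ∧ R f := by
  induction l generalizing st with
  | nil =>
    refine (hP st hn hmat hset fun i hi => hL i hi (by simp)).trans ⟨fun h => ?_, ?_⟩
    · exact ⟨st.env, by simp, by simp, h⟩
    · rintro ⟨f, -, hf, h⟩
      rwa [show st.env = f from funext fun i => (hf i (by simp)).symm]
  | cons i l ih =>
    have ih' : ∀ x < st.n, Exs P l (st.assign i x (st.n - (x + 1))) ↔ _ := fun x hx =>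
      ih (st.assign i x (st.n - (x + 1))) hn hmat hset (fun j hj hjl => by
        by_cases hji : j = i
        · subst hji
          simpa [← hn] using hx
        · simpa [hji] using hL j hj (by simp [hji, hjl]))
    simp only [Exs]
    constructor
    · rintro ⟨x, hx, h⟩
      obtain ⟨f, h1, h2, h3⟩ := (ih' x hx).1 h
      refine ⟨f, fun j hj => ?_, fun j hj => ?_, h3⟩
      · by_cases hjl : j ∈ l
        · exact h1 j hjl
        · obtain rfl : j = i := by simpa [hjl] using hj
          rw [h2 j hjl]
          simpa [← hn] using hx
      · simp only [List.mem_cons, not_or] at hj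
        rw [h2 j hj.2]
        simp [hj.1]
    · rintro ⟨f, h1, h2, h3⟩
      have hi : f i < st.n := hn ▸ h1 i (by simp)
      refine ⟨f i, hi, (ih' _ hi).2 ⟨f, fun j hj => h1 j (by simp [hj]), fun j hj => ?_, h3⟩⟩
      by_cases hji : j = i
      · subst hji
        simp
      · simpa [hji] using h2 j (by simp [hji, hj])

/-- Later rounds only put bits in front of the list, so the decision at `x`, made with the list of
length `x`, stays at place `x` when read from the end. -/
theorem mem_iterSet {P : Store ι → Prop} {i : ι} {st : Store ι} (j x : ℕ) :
    (iterSet P i st j).reverse[x]? = some true ↔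
      x < j ∧ P ({ st with set := iterSet P i st x }.assign i x (st.n - (x + 1))) := by
  induction j with
  | zero => simp [iterSet]
  | succ j ih =>
    have hlen := length_iterSet P i st j
    rw [iterSet, List.reverse_cons]
    rcases lt_trichotomy x j with h | h | h
    · rw [List.getElem?_append_left (by simpa [hlen] using h), ih]
      simp [h, h.trans (Nat.lt_succ_self j)]
    · subst h
      rw [List.getElem?_append_right (by simp [hlen])]
      simp [hlen]
    · rw [List.getElem?_eq_none (by simp [hlen]; omega)]
      simp [show ¬x < j + 1 by omega]

end

/-! ### The search algorithm and its correctness. -/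

/-- The variables of the algorithm. -/
inductive Var (p : ℕ) : Type
  | v | w | x | y
  | a (j : Fin p)
  | b (j : Fin p)
  deriving DecidableEq, Fintype

section

variable {p : ℕ}

/-- The vertex `w` is chosen by the greedy procedure. -/
def GreedyStep (st : Store (Var p)) : Prop :=
  (¬(¬st.env .w < st.env .v ∧ ¬st.env .v < st.env .w) ∧ ¬st.Adj (st.env .w) (st.env .v)) ∧
    (¬∃ x < st.n, st.Mem x ∧ st.Adj x (st.env .w)) ∧ ∀ j ∈ List.finRange p,
      st.env .w < st.env (.a j) →
        ¬st.Adj (st.env .w) (st.env (.a j)) ∧ ¬st.Adj (st.env .w) (st.env (.b j))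

/-- All neighbours of the vertex `v` are dominated by the current set. -/
def NeighborsDominated (st : Store (Var p)) : Prop :=
  ¬∃ x < st.n, st.Adj (st.env .v) x ∧ ¬∃ y < st.n, st.Mem y ∧ st.Adj y x

/-- The set chosen by the greedy procedure dominates all neighbours of the vertex `v`. -/
def GreedyDominates (st : Store (Var p)) : Prop :=
  NeighborsDominated { st with set := iterSet GreedyStep .w st st.n }

/-- The variables over whose values the algorithm searches. -/
def searchVars (p : ℕ) : List (Var p) :=
  .v :: ((List.finRange p).map .a ++ (List.finRange p).map .b)

theorem nodup_searchVars : (searchVars p).Nodup := by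
  refine List.nodup_cons.2 ⟨by simp, List.Nodup.append ?_ ?_ ?_⟩
  · exact (List.nodup_finRange p).map fun _ _ h => Var.a.inj h
  · exact (List.nodup_finRange p).map fun _ _ h => Var.b.inj h
  · simp [List.disjoint_left]

/-- Values are compared only by `<`, which is why `w ≠ v` enters `GreedyStep` as a combination of
two strict inequalities. -/
theorem comp_greedyStep : Comp (fun st : Store (Var p) => (st.env .x = 0 ∧ st.rem .x = 0) ∧
    st.env .y = 0 ∧ st.rem .y = 0) GreedyStep := by
  refine (((Comp.lt (by simp)).not.and (Comp.lt (by simp)).not).not.and (Comp.adj _ _).not).and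
    ((Comp.not ?_).and (Comp.list_all _ fun j _ => (Comp.lt (by simp)).imp_right
      ((Comp.adj _ _).not.and (Comp.adj _ _).not)))
  refine (Comp.ex (i := .x) (Q := fun _ => True) ((Comp.mem .x).and (Comp.adj .x .w))
    (fun st h => h.1) (fun _ _ _ _ => trivial)).congr fun st _ => ?_
  simp

theorem comp_neighborsDominated : Comp (fun st : Store (Var p) =>
    (st.env .x = 0 ∧ st.rem .x = 0) ∧ st.env .y = 0 ∧ st.rem .y = 0) NeighborsDominated := by
  have h1 := Comp.ex (i := .y) (Q := fun _ : Store (Var p) => True)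
    (Q' := fun st => st.env .y = 0 ∧ st.rem .y = 0)
    ((Comp.mem .y).and (Comp.adj .y .x)) (fun st h => h) (fun _ _ _ _ => trivial)
  refine (Comp.ex (i := .x) ((Comp.adj .v .x).and h1.not) (fun st h => h.1)
    (fun st h _ _ => by simpa using h.2)).not.congr fun st _ => ?_
  simp [NeighborsDominated]

theorem comp_greedyDominates : Comp (fun st : Store (Var p) => st.set = [] ∧
    ∀ i ∈ ({.w, .x, .y} : Set (Var p)), st.env i = 0 ∧ st.rem i = 0) GreedyDominates :=
  Comp.iterate comp_greedyStep comp_neighborsDominated (fun st h => ⟨h.1, h.2 .w (by simp)⟩)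
    (fun st h l x r => by simpa using ⟨h.2 .x (by simp), h.2 .y (by simp)⟩)
    (fun st h l => ⟨h.2 .x (by simp), h.2 .y (by simp)⟩)

theorem comp_uniqueKey : Comp (fun st : Store (Var p) => st.set = [] ∧
    ∀ i, st.env i = 0 ∧ st.rem i = 0)
    fun st => (∃ x < st.n, True) ∧ ¬Exs GreedyDominates (searchVars p) st := by
  refine Comp.and ?_ (Comp.not ?_)
  · exact Comp.ex (i := .x) (Q := fun _ => True) (P := fun _ => True) Comp.trivial
      (fun st h => h.2 _) (fun _ _ _ _ => trivial)
  · exact (Comp.exs (searchVars p) nodup_searchVars {.w, .x, .y}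
      (by rintro (_ | _ | _ | _ | j | j) <;> simp [searchVars])
      comp_greedyDominates).imp fun st h => ⟨h.1, fun i _ => h.2 i⟩

theorem greedyDominates_iff {G : FiniteGraph} {st : Store (Var p)} (hn : st.n = G.1)
    (hmat : st.mat = (graphStore (Var p) G).mat) {v : Fin G.1} {a b : Fin p → Fin G.1}
    (hv : st.env .v = v) (ha : ∀ j, st.env (.a j) = a j) (hb : ∀ j, st.env (.b j) = b j) :
    GreedyDominates st ↔ ∃ T : Set (Fin G.1), G.2.IsGreedy v a b T ∧
      ∀ u, G.2.Adj v u → ∃ t ∈ T, G.2.Adj t u := by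
  have hadj := adj_of_mat_eq hmat hn
  -- At round `w` the list read by `GreedyStep` is exactly the part of `T` below `w`, so the
  -- recursion of `iterSet` becomes the one defining `IsGreedy`.
  let T : Set (Fin G.1) := {x | (iterSet GreedyStep .w st st.n).reverse[x.1]? = some true}
  have hmem : ∀ x : Fin G.1, x ∈ T ↔ GreedyStep
      ({ st with set := iterSet GreedyStep .w st x }.assign .w x (st.n - (x + 1))) := by
    intro x
    refine (mem_iterSet _ _).trans (and_iff_right ?_)
    rw [hn]
    exact x.2
  have hlt : ∀ w x : Fin G.1, (iterSet GreedyStep .w st w).reverse[x.1]? = some true ↔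
      x < w ∧ x ∈ T := by
    intro w x
    rw [mem_iterSet, hmem]
    rfl
  have hex : ∀ {R : ℕ → Prop}, (∃ x < st.n, R x) ↔ ∃ x : Fin G.1, R x := by
    intro R
    rw [hn]
    exact ⟨fun ⟨x, hx, h⟩ => ⟨⟨x, hx⟩, h⟩, fun ⟨x, h⟩ => ⟨x, x.2, h⟩⟩
  have hT : G.2.IsGreedy v a b T := by
    intro w
    rw [hmem]
    have h1 : ∀ x y, ({ st with set := iterSet GreedyStep .w st w } : Store (Var p)).Adj x y ↔
      st.Adj x y := fun _ _ => Iff.rfl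
    have h2 : ∀ x : Fin G.1, ({ st with set := iterSet GreedyStep .w st w } : Store (Var p)).Mem x ↔
      x < w ∧ x ∈ T := hlt w
    simp only [GreedyStep, Store.assign_adj, Store.assign_Mem, Store.assign_n, Store.assign_env,
      Function.update_self, ne_eq, reduceCtorEq, not_false_eq_true, Function.update_of_ne, h1,
      hv, ha, hb, hex, h2, hadj, List.mem_finRange, true_imp_iff, Fin.val_fin_lt]
    refine and_congr (and_congr_left fun _ => ?_) (and_congr_left fun _ => ?_)
    · rw [← not_or, not_not, ← ne_iff_lt_or_gt]
    · simp only [not_exists, not_and, and_imp]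
  have h1 : GreedyDominates st ↔ ∀ u, G.2.Adj v u → ∃ t ∈ T, G.2.Adj t u := by
    have h2 : ∀ x y, ({ st with set := iterSet GreedyStep .w st st.n } : Store (Var p)).Adj x y ↔
      st.Adj x y := fun _ _ => Iff.rfl
    have h3 : ∀ x : Fin G.1,
      ({ st with set := iterSet GreedyStep .w st st.n } : Store (Var p)).Mem x ↔ x ∈ T :=
      fun _ => Iff.rfl
    simp only [GreedyDominates, NeighborsDominated, h2, hv, hex, hadj, h3]
    simp only [not_exists, not_and]
    push Not
    rfl
  rw [h1]
  -- Uniqueness of the greedy set turns the existential over sets into a statement about the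
  -- computed one.
  exact ⟨fun h => ⟨T, hT, h⟩, fun ⟨T', hT', h⟩ => hT.unique hT' ▸ h⟩

theorem exs_greedyDominates_iff (G : FiniteGraph) :
    Exs GreedyDominates (searchVars p) (graphStore (Var p) G) ↔
      ∃ (v : Fin G.1) (a b : Fin p → Fin G.1) (T : Set (Fin G.1)), G.2.IsGreedy v a b T ∧
        ∀ u, G.2.Adj v u → ∃ t ∈ T, G.2.Adj t u := by
  rw [exs_iff (n := G.1) (mat := (graphStore (Var p) G).mat) (L := searchVars p)
    (R := fun f => ∃ (v : Fin G.1) (a b : Fin p → Fin G.1), (f .v = v ∧ (∀ j, f (.a j) = a j) ∧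
      ∀ j, f (.b j) = b j) ∧ ∃ T : Set (Fin G.1), G.2.IsGreedy v a b T ∧
        ∀ u, G.2.Adj v u → ∃ t ∈ T, G.2.Adj t u) ?_ _ _ rfl rfl rfl (fun i hi h => absurd hi h)]
  · constructor
    · rintro ⟨f, -, -, v, a, b, -, h⟩
      exact ⟨v, a, b, h⟩
    · rintro ⟨v, a, b, h⟩
      refine ⟨fun | .v => v | .a j => a j | .b j => b j | _ => 0, ?_, ?_, v, a, b, by simp, h⟩
      · rintro (_ | _ | _ | _ | j | j) <;> simp [searchVars]
      · rintro (_ | _ | _ | _ | j | j) <;> simp [searchVars, graphStore]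
  · intro st hn hmat _ hL
    have hv := hL .v (by simp [searchVars])
    have ha : ∀ j, st.env (.a j) < G.1 := fun j => hL _ (by simp [searchVars])
    have hb : ∀ j, st.env (.b j) < G.1 := fun j => hL _ (by simp [searchVars])
    constructor
    · intro h
      exact ⟨⟨_, hv⟩, fun j => ⟨_, ha j⟩, fun j => ⟨_, hb j⟩, ⟨rfl, fun _ => rfl, fun _ => rfl⟩,
        (greedyDominates_iff hn hmat rfl (fun _ => rfl) fun _ => rfl).1 h⟩
    · rintro ⟨v, a, b, ⟨h1, h2, h3⟩, h⟩
      exact (greedyDominates_iff hn hmat h1 h2 h3).2 h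

end

end StackProg

theorem mainTheorem11 (p : ℕ) :
    DecidableInPolyTimeOn encodeGraph
      (fun G : FiniteGraph => InducedMatchingsAtMost G.2 p)
      (fun G : FiniteGraph => IsUniqueKeyGraph G.2) := by
  refine StackProg.decidableInPolyTimeOn_of_comp (StackProg.comp_uniqueKey (p := p)) _ _
    fun G hG => ?_
  rw [isUniqueKeyGraph_iff, StackProg.exs_greedyDominates_iff, ← exists_shields_iff hG]
  refine and_congr ?_ (by push Not; rfl)
  exact ⟨fun ⟨x⟩ => ⟨x, x.2, trivial⟩, fun ⟨x, hx, _⟩ => ⟨⟨x, hx⟩⟩⟩
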